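/- Let $K=\mathbb{F}_q$ be a finite field, $s\ge 2$, and let $A_1,\dots,A_{s-1}\subseteq K$ have cardinalities $d_i=|A_i|$ with $2\le d_1\le\cdots\le d_{s-1}$. Let $$\mathbb{X}=[A_1\times\cdots\times A_{s-1}\times\{1\}]=\{[P_1],\dots,[P_m]\}\subseteq\mathbb{P}^{s-1},\qquad m=|\mathbb{X}|,$$ with arbitrary representatives $P_i\in K^s\setminus\{0\}$. Let $d\ge 1$, let $S_d$ be the space of homogeneous polynomials of degree $d$ in $K[t_1,\dots,t_s]$, choose any $h_i\in S_d$ with $h_i(P_i)\ne 0$, and let $$C_{\mathbb{X}}(d)=\left\{\left(\tfrac{h(P_1)}{h_1(P_1)},\dots,\tfrac{h(P_m)}{h_m(P_m)}\right): h\in S_d\right\}\subseteq K^m .$$ For a linear code $C\subseteq K^m$, let $\delta_r(C)$ be its $r$-th generalized Hamming weight: the minimum, over the $r$-dimensional linear subspaces $D\subseteq C$, of the number of positions $i$ such that some $a\in D$ has $a_i\neq 0$. If $d\le\sum_{i=1}^{s-1}(d_i-1)$, there are unique integers $k,\ell$ with $0\le k\le s-2$, $d=\sum_{i=1}^{k}(d_i-1)+\ell$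 and $1\le\ell\le d_{k+1}-1$. For such $k,\ell$, $$\delta_r(C_{\mathbb{X}}(d))=\begin{cases} d_{k+r+1}\cdots d_{s-1}\,\bigl[(d_{k+1}-\ell+1)\,d_{k+2}\cdots d_{k+r}-1\bigr] & \text{if } 1\le r<s-k-1,\\[4pt] (d_{k+1}-\ell+1)\,d_{k+2}\cdots d_{s-1}-1 & \text{if } 1\le r=s-k-1,\end{cases}$$ where $d_i\cdots d_j=1$ if $i>j$. -/

import Mathlib

noncomputable section

open scoped LinearAlgebra.Projectivization

/-- The support `χ(D)` of a linear code `D ⊆ K^ι`: the positions at which some codeword of `D`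
is nonzero. -/
def codeSupport {K ι : Type*} [Field K] (D : Submodule K (ι → K)) : Set ι :=
  {i | ∃ a ∈ D, a i ≠ 0}

/-- The `r`-th generalized Hamming weight `δ_r(C)`: the smallest size of the support of an
`r`-dimensional subcode of `C`. (If there is no such subcode the infimum is `0` by convention.
For `r ≥ 1` a nonzero-dimensional subcode has nonempty support, so a positive value is always
attained by an actual subcode.) -/
def genHammingWeight {K ι : Type*} [Field K] (C : Submodule K (ι → K)) (r : ℕ) : ℕ :=
  sInf {w | ∃ D : Submodule K (ι → K), D ≤ C ∧ Module.finrank K D = r ∧ (codeSupport D).ncard = w}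

/-- The evaluation map `S_d → K^m`, `f ↦ (f(P_1)/h_1(P_1), …, f(P_m)/h_m(P_m))`, where `S_d` is
the space of homogeneous polynomials of degree `d` in `s` variables. -/
def evalMap {K : Type*} [Field K] {s m : ℕ} (d : ℕ) (P : Fin m → Fin s → K)
    (h : Fin m → MvPolynomial (Fin s) K) :
    MvPolynomial.homogeneousSubmodule (Fin s) K d →ₗ[K] (Fin m → K) where
  toFun f := fun i => MvPolynomial.eval (P i) (f : MvPolynomial (Fin s) K) /
    MvPolynomial.eval (P i) (h i)
  map_add' f g := by
    funext i
    simp [add_div]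
  map_smul' c f := by
    funext i
    simp [mul_div_assoc]

/-- The Reed--Muller-type code of order `d`: the image of the evaluation map. -/
def reedMullerTypeCode {K : Type*} [Field K] {s m : ℕ} (d : ℕ) (P : Fin m → Fin s → K)
    (h : Fin m → MvPolynomial (Fin s) K) : Submodule K (Fin m → K) :=
  LinearMap.range (evalMap d P h)

theorem snoc_one_ne_zero {K : Type*} [Field K] {n : ℕ} (a : Fin n → K) :
    (Fin.snoc a 1 : Fin (n + 1) → K) ≠ 0 := by
  intro h
  have := congrFun h (Fin.last n)
  simp at this

/-- The projective cartesian set `[A_1 × ⋯ × A_n × {1}] ⊆ ℙ^n`. -/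
def projCartesianSet {K : Type*} [Field K] {n : ℕ} (A : Fin n → Finset K) :
    Set (ℙ K (Fin (n + 1) → K)) :=
  {p | ∃ a : Fin n → K, (∀ i, a i ∈ A i) ∧
    p = Projectivization.mk K (Fin.snoc a 1 : Fin (n + 1) → K) (snoc_one_ne_zero a)}

/-- For the integers `δ 1, …, δ n`: the decomposition `d = ∑_{i=1}^{k} (δ i - 1) + ℓ` with
`0 ≤ k < n` and `1 ≤ ℓ ≤ δ (k + 1) - 1`. -/
def IsDegreeDecomposition (n : ℕ) (δ : ℕ → ℕ) (d k ℓ : ℕ) : Prop :=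
  k + 1 ≤ n ∧ d = (∑ i ∈ Finset.Icc 1 k, (δ i - 1)) + ℓ ∧ 1 ≤ ℓ ∧ ℓ ≤ δ (k + 1) - 1

end

/-!
# Generalized Hamming weights of projective cartesian codes

After scaling, a codeword of the Reed--Muller-type code is the function on the grid
`A 0 × ⋯ × A (n - 1)` given by a polynomial of degree at most `d`. Enumerating `A i` by `a i t`,
`t < D i`, both the grid points and the reduced monomials are indexed by the box of all exponent
vectors `u` with `u i < D i`. The Newton polynomials `∏ i, ∏ t < u i, (x_i - a i t)` form a basis
of the functions on the grid. The one with exponent `u` vanishes at the point with index `v` unless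
`u ≤ v`, and multiplication by a coordinate acts on this basis in a triangular way.

*Footprint bound.* For a subcode `W`, consider the ideal of all functions vanishing off the support
of `W`. Its dimension is the size of the support, and its lexicographic leading exponents form an
upset of the box, which contains the `dim W` leading exponents of `W`, all of degree at most `d`
(`exists_isBoxUpset_card_le`).

*Smallest upsets.* It remains to bound below the size of an upset with `r` elements of degree at
most `d`. As the sides of the box are in increasing order, compressing the upset along the
diagonals `u i + u j = const` with `i < j` keeps it an upset and keeps its number of elements in
each degree, so the upset may be taken strongly stable (`exists_isBoxStable`). Let
`e = (D 0 - 1, …, D (k - 1) - 1, ℓ - 1, 0, …, 0)`, the lexicographically first exponent vector of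
degree `d - 1`. A stable upset containing an element of degree at most `d - 1` contains `e`, so it
has at least `∏ (D i - e i)` elements. Otherwise all `r` elements have degree exactly `d`. If `w` is
one of them and `p` is its last nonzero coordinate, stability gives all the elements above `w` with
a unit removed at `p`, except those that agree with that vector in the coordinates up to `p`. If
some `p` is at least `k + r - 1`, this is the bound `∏ (D i - e i) - ∏_{i ≥ k + r} D i`. Otherwise
two of the elements have the same `p`, and the second one makes up for the elements missing above
the first one (`IsLexFirst.prod_sub_le_card_add`).

The bound is attained by the span of the Newton functions whose exponents cover `e` in the
coordinates `k, …, k + r - 1` (`genHammingWeight_eq_of_newton`).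
-/

/-! ### Compression of upsets in a box -/

/-! In the next three lemmas, `X` and `Y` describe the elements of an upset of the planar box
`a × b`, where `a ≤ b`, on the diagonals `x + y = e` and `x + y = e + 1`, through their first
coordinates. -/

section DiagonalCounting

variable {a b e : ℕ} {X Y : Finset ℕ}

theorem card_lt_card_diagonal (hab : a ≤ b) (h1 : ∀ t ∈ X, t ≤ e)
    (hY1 : ∀ t ∈ X, t + 1 < a → t + 1 ∈ Y) (hY2 : ∀ t ∈ X, e + 1 < t + b → t ∈ Y)
    (hne : X.Nonempty) (he : e + 1 < a) : X.card + 1 ≤ Y.card := by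
  have hmax := X.max'_mem hne
  have hnot : X.max' hne + 1 ∉ X := fun h => by
    have := X.le_max' _ h
    omega
  rw [← Finset.card_insert_of_notMem hnot]
  refine Finset.card_le_card fun t ht => ?_
  rcases Finset.mem_insert.1 ht with rfl | ht
  · exact hY1 _ hmax (by have := h1 _ hmax; omega)
  · exact hY2 _ ht (by omega)

theorem card_le_card_diagonal (hY2 : ∀ t ∈ X, e + 1 < t + b → t ∈ Y) (he : e + 1 < b) :
    X.card ≤ Y.card :=
  Finset.card_le_card fun t ht => hY2 t ht (by omega)

/-- On the diagonals that are cut off by the side `b`, the number of elements can only decrease if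
the diagonal is full, that is, because the next diagonal, which has `a + b - 2 - e` elements, is
shorter. -/
theorem min_card_le_card_diagonal (h1 : ∀ t ∈ X, e < t + b)
    (hY1 : ∀ t ∈ X, t + 1 < a → t + 1 ∈ Y) (hY2 : ∀ t ∈ X, e + 1 < t + b → t ∈ Y)
    (he : b ≤ e + 1) : min X.card (a + b - 2 - e) ≤ Y.card := by
  by_cases hlo : e + 1 - b ∈ X
  · by_cases hg : ∃ g, e + 1 - b < g ∧ g < a ∧ g ∉ X
    · classical
      obtain ⟨hg1, hg2, hg3⟩ := Nat.find_spec hg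
      have hmin := fun m => Nat.find_min hg (m := m)
      set g := Nat.find hg
      have hprev : g - 1 ∈ X := by
        by_contra hcon
        rcases Nat.lt_or_ge (e + 1 - b) (g - 1) with h | h
        · exact hmin (g - 1) (by omega) ⟨h, by omega, hcon⟩
        · have : g - 1 = e + 1 - b := by omega
          exact hcon (this ▸ hlo)
      have hgY : g ∈ Y := by
        have := hY1 _ hprev (by omega)
        rwa [Nat.sub_add_cancel (by omega)] at this
      have hcard : (insert g (X.erase (e + 1 - b))).card = X.card := by
        rw [Finset.card_insert_of_notMem (fun h => hg3 (Finset.mem_of_mem_erase h)),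
          Finset.card_erase_add_one hlo]
      refine (min_le_left _ _).trans (hcard ▸ Finset.card_le_card fun t ht => ?_)
      rcases Finset.mem_insert.1 ht with rfl | ht
      · exact hgY
      · obtain ⟨h2, h3⟩ := Finset.mem_erase.1 ht
        exact hY2 t h3 (by have := h1 t h3; omega)
    · push Not at hg
      have hsub : Finset.Ioo (e + 1 - b) a ⊆ Y := fun t ht => by
        rw [Finset.mem_Ioo] at ht
        exact hY2 t (hg t ht.1 ht.2) (by omega)
      have := Finset.card_le_card hsub
      rw [Nat.card_Ioo] at this
      exact (min_le_right _ _).trans (by omega)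
  · refine (min_le_left _ _).trans (Finset.card_le_card fun t ht => hY2 t ht ?_)
    have := h1 t ht
    have : t ≠ e + 1 - b := fun h => hlo (h ▸ ht)
    omega

/-- Among the sets of naturals below `M + 1` of a given size, the final segment minimizes the sum
of a strictly decreasing function, and it alone does so. -/
theorem sum_Ico_lt_sum_of_ne {φ : ℕ → ℕ} {M : ℕ} (hφ : ∀ s t, s < t → t ≤ M → φ t < φ s)
    (hX : ∀ t ∈ X, t ≤ M) (hne : X ≠ Finset.Ico (M + 1 - X.card) (M + 1)) :
    ∑ t ∈ Finset.Ico (M + 1 - X.card) (M + 1), φ t < ∑ t ∈ X, φ t := by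
  have hcard : X.card ≤ M + 1 := by
    have : X ⊆ Finset.range (M + 1) := fun t ht => by
      have := hX t ht
      rw [Finset.mem_range]; omega
    simpa using Finset.card_le_card this
  set T := Finset.Ico (M + 1 - X.card) (M + 1) with hT
  have hTX : T.card = X.card := by rw [hT, Nat.card_Ico]; omega
  have hcardeq : (T \ X).card = (X \ T).card := by
    have h1 := Finset.card_sdiff_add_card_inter T X
    have h2 := Finset.card_sdiff_add_card_inter X T
    rw [Finset.inter_comm] at h2
    omega
  have hnon : (X \ T).Nonempty := by
    rw [Finset.sdiff_nonempty]
    exact fun h => hne (Finset.eq_of_subset_of_card_le h hTX.le)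
  have hpos : 0 < (X \ T).card := hnon.card_pos
  rw [← Finset.sum_inter_add_sum_sdiff T X, ← Finset.sum_inter_add_sum_sdiff X T,
    Finset.inter_comm X T]
  refine Nat.add_lt_add_left ?_ _
  set c := φ (M + 1 - X.card)
  have h1 : ∑ t ∈ T \ X, φ t ≤ (T \ X).card * c := by
    rw [← smul_eq_mul]
    refine Finset.sum_le_card_nsmul _ _ _ fun t ht => ?_
    rw [Finset.mem_sdiff, hT, Finset.mem_Ico] at ht
    rcases ht.1.1.eq_or_lt with h | h
    · rw [← h]
    · exact (hφ _ _ h (by omega)).le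
  have h2 : (X \ T).card * (c + 1) ≤ ∑ t ∈ X \ T, φ t := by
    rw [← smul_eq_mul]
    refine Finset.card_nsmul_le_sum _ _ _ fun t ht => ?_
    rw [Finset.mem_sdiff, hT, Finset.mem_Ico] at ht
    have := hX t ht.1
    refine hφ _ _ (by by_contra h; exact ht.2 ⟨by omega, by omega⟩) ?_
    have := Finset.card_pos.2 ⟨t, ht.1⟩
    omega
  rw [hcardeq] at h1
  nlinarith

end DiagonalCounting

/-- The exponent vectors `u` with `u i < D i` for all `i`: the exponents of the monomials that are
reduced with respect to a grid whose `i`-th side has `D i` elements. -/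
def exponentBox {n : ℕ} (D : Fin n → ℕ) : Finset (Fin n → ℕ) :=
  Fintype.piFinset fun i => Finset.range (D i)

/-- `U` is upward closed within the box. -/
def IsBoxUpset {n : ℕ} (D : Fin n → ℕ) (U : Finset (Fin n → ℕ)) : Prop :=
  U ⊆ exponentBox D ∧ ∀ u ∈ U, ∀ v ∈ exponentBox D, u ≤ v → v ∈ U

/-- The vector `u` with its entries at `i` and `j` replaced by `x` and `y`. -/
def updatePair {n : ℕ} (i j : Fin n) (u : Fin n → ℕ) (x y : ℕ) : Fin n → ℕ :=
  Function.update (Function.update u i x) j y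

/-- `U` is strongly stable: it is closed under moving a unit of an exponent from a coordinate to
an earlier one, as far as the box permits. -/
def IsBoxStable {n : ℕ} (D : Fin n → ℕ) (U : Finset (Fin n → ℕ)) : Prop :=
  ∀ u ∈ U, ∀ i j, i < j → 0 < u j → u i + 1 < D i → updatePair i j u (u i + 1) (u j - 1) ∈ U

/-- The part of `U` on the diagonal `x + y = e` of the plane through `u` in the directions `i` and
`j`, described by the entry `x` at `i`. -/
def diagonalSection {n : ℕ} (i j : Fin n) (U : Finset (Fin n → ℕ)) (u : Fin n → ℕ) (e : ℕ) :
    Finset ℕ :=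
  (Finset.range (e + 1)).filter fun t => updatePair i j u t (e - t) ∈ U

/-- The compression of `U` in the directions `i` and `j`: on every diagonal `u i + u j = e` of a
plane in these directions, the elements of `U` are replaced by as many elements of the box with
`u i` as large as possible. -/
def boxCompression {n : ℕ} (D : Fin n → ℕ) (i j : Fin n) (U : Finset (Fin n → ℕ)) :
    Finset (Fin n → ℕ) :=
  (exponentBox D).filter fun u =>
    min (u j) (D i - 1 - u i) < (diagonalSection i j U u (u i + u j)).card

section Compression

variable {n : ℕ} {D : Fin n → ℕ} {i j : Fin n} {U : Finset (Fin n → ℕ)}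

theorem mem_exponentBox {u : Fin n → ℕ} : u ∈ exponentBox D ↔ ∀ i, u i < D i := by
  simp [exponentBox]

theorem updatePair_apply_left (hij : i ≠ j) (u : Fin n → ℕ) (x y : ℕ) :
    updatePair i j u x y i = x := by
  simp [updatePair, hij]

theorem updatePair_apply_right (u : Fin n → ℕ) (x y : ℕ) : updatePair i j u x y j = y := by
  simp [updatePair]

theorem updatePair_apply_of_ne {l : Fin n} (hi : l ≠ i) (hj : l ≠ j) (u : Fin n → ℕ) (x y : ℕ) :
    updatePair i j u x y l = u l := by
  simp [updatePair, hi, hj]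

theorem updatePair_congr {u v : Fin n → ℕ} (h : ∀ l, l ≠ i → l ≠ j → u l = v l) (x y : ℕ) :
    updatePair i j u x y = updatePair i j v x y := by
  funext l
  by_cases hj : l = j
  · subst hj; simp [updatePair]
  · by_cases hi : l = i
    · subst hi; simp [updatePair, hj]
    · rw [updatePair_apply_of_ne hi hj, updatePair_apply_of_ne hi hj, h l hi hj]

theorem updatePair_self (u : Fin n → ℕ) : updatePair i j u (u i) (u j) = u := by
  simp [updatePair]

theorem updatePair_updatePair (u : Fin n → ℕ) (x y x' y' : ℕ) :
    updatePair i j (updatePair i j u x y) x' y' = updatePair i j u x' y' :=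
  updatePair_congr (fun _ hi hj => updatePair_apply_of_ne hi hj u x y) _ _

theorem updatePair_mono {u v : Fin n → ℕ} (h : ∀ l, l ≠ i → l ≠ j → u l ≤ v l) {x y x' y' : ℕ}
    (hx : x ≤ x') (hy : y ≤ y') : updatePair i j u x y ≤ updatePair i j v x' y' := by
  intro l
  by_cases hj : l = j
  · subst hj; simpa [updatePair] using hy
  · by_cases hi : l = i
    · subst hi; simpa [updatePair, hj] using hx
    · rw [updatePair_apply_of_ne hi hj, updatePair_apply_of_ne hi hj]
      exact h l hi hj

theorem updatePair_mem_exponentBox (hij : i ≠ j) {u : Fin n → ℕ} {x y : ℕ} :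
    updatePair i j u x y ∈ exponentBox D ↔
      x < D i ∧ y < D j ∧ ∀ l, l ≠ i → l ≠ j → u l < D l := by
  rw [mem_exponentBox]
  constructor
  · intro h
    refine ⟨?_, ?_, fun l hi hj => ?_⟩
    · simpa [updatePair_apply_left hij] using h i
    · simpa [updatePair_apply_right] using h j
    · simpa [updatePair_apply_of_ne hi hj] using h l
  · rintro ⟨h1, h2, h3⟩ l
    by_cases hj : l = j
    · subst hj; simpa [updatePair] using h2
    · by_cases hi : l = i
      · subst hi; simpa [updatePair, hj] using h1
      · rw [updatePair_apply_of_ne hi hj]; exact h3 l hi hj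

theorem sum_updatePair (hij : i ≠ j) (c u : Fin n → ℕ) (x y : ℕ) :
    ∑ l, c l * updatePair i j u x y l =
      c i * x + c j * y + ∑ l ∈ (Finset.univ.erase i).erase j, c l * u l := by
  rw [← Finset.add_sum_erase _ _ (Finset.mem_univ i),
    ← Finset.add_sum_erase (Finset.univ.erase i) _ (Finset.mem_erase.2 ⟨hij.symm, Finset.mem_univ j⟩),
    updatePair_apply_left hij, updatePair_apply_right, add_assoc]
  congr 2
  refine Finset.sum_congr rfl fun l hl => ?_
  simp only [Finset.mem_erase] at hl
  rw [updatePair_apply_of_ne hl.2.1 hl.1]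

theorem diagonalSection_congr {u v : Fin n → ℕ} (h : ∀ l, l ≠ i → l ≠ j → u l = v l) (e : ℕ) :
    diagonalSection i j U u e = diagonalSection i j U v e := by
  unfold diagonalSection
  simp only [updatePair_congr h]

theorem mem_diagonalSection {u : Fin n → ℕ} {e t : ℕ} :
    t ∈ diagonalSection i j U u e ↔ t ≤ e ∧ updatePair i j u t (e - t) ∈ U := by
  simp [diagonalSection]

theorem IsBoxUpset.of_step (hU : U ⊆ exponentBox D)
    (h : ∀ u ∈ U, ∀ l, u l + 1 < D l → Function.update u l (u l + 1) ∈ U) : IsBoxUpset D U := by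
  refine ⟨hU, fun u hu v hv huv => ?_⟩
  obtain ⟨N, hN⟩ : ∃ N, ∑ l, (v l - u l) = N := ⟨_, rfl⟩
  induction N generalizing u with
  | zero =>
    have : u = v := by
      funext l
      have h1 : v l - u l = 0 := (Finset.sum_eq_zero_iff.1 hN) l (Finset.mem_univ l)
      have h2 : u l ≤ v l := huv l
      omega
    exact this ▸ hu
  | succ N ih =>
    obtain ⟨l, -, hl⟩ : ∃ l ∈ Finset.univ, v l - u l ≠ 0 :=
      Finset.exists_ne_zero_of_sum_ne_zero (by omega)
    have hvl := mem_exponentBox.1 hv l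
    refine ih _ (h u hu l (by omega)) (fun l' => ?_) ?_
    · by_cases hl' : l' = l
      · subst hl'; simp; omega
      · simpa [hl'] using huv l'
    · have h1 := Finset.add_sum_erase Finset.univ (fun l => v l - u l) (Finset.mem_univ l)
      rw [← Finset.add_sum_erase _ _ (Finset.mem_univ l), Finset.sum_congr rfl
        (g := fun l => v l - u l)]
      · rw [Function.update_self]
        omega
      · intro l' hl'
        rw [Function.update_of_ne (Finset.ne_of_mem_erase hl')]

/-- The diagonals of the compression are final segments. -/
theorem diagonalSection_boxCompression (hij : i ≠ j) (hU : U ⊆ exponentBox D)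
    (u : Fin n → ℕ) (e : ℕ) :
    diagonalSection i j (boxCompression D i j U) u e =
      Finset.Ico (min e (D i - 1) + 1 - (diagonalSection i j U u e).card)
        (min e (D i - 1) + 1) := by
  set X := diagonalSection i j U u e with hX
  have hbox : ∀ t ∈ X, t ≤ e ∧ t < D i ∧ e - t < D j ∧ ∀ l, l ≠ i → l ≠ j → u l < D l := by
    intro t ht
    obtain ⟨h1, h2⟩ := mem_diagonalSection.1 ht
    exact ⟨h1, (updatePair_mem_exponentBox hij).1 (hU h2)⟩
  have hsec : ∀ t, t ≤ e → diagonalSection i j U (updatePair i j u t (e - t))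
      (updatePair i j u t (e - t) i + updatePair i j u t (e - t) j) = X := by
    intro t ht
    rw [updatePair_apply_left hij, updatePair_apply_right, Nat.add_sub_cancel' ht, hX]
    exact diagonalSection_congr (fun l hi hj => updatePair_apply_of_ne hi hj _ _ _) _
  ext t
  rw [mem_diagonalSection, Finset.mem_Ico, boxCompression, Finset.mem_filter,
    updatePair_mem_exponentBox hij]
  rcases X.eq_empty_or_nonempty with hemp | ⟨s, hs⟩
  · constructor
    · rintro ⟨h1, h2, h3⟩
      rw [hsec t h1, hemp] at h3
      simp at h3
    · rw [hemp, Finset.card_empty]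
      omega
  · have hcard : X.card ≤ min e (D i - 1) + 1 - (e + 1 - D j) := by
      have : X ⊆ Finset.Ico (e + 1 - D j) (min e (D i - 1) + 1) := fun t ht => by
        have := hbox t ht
        rw [Finset.mem_Ico]
        omega
      simpa using Finset.card_le_card this
    have hpos : 0 < X.card := Finset.card_pos.2 ⟨s, hs⟩
    obtain ⟨hs1, hs2, hs3, hs4⟩ := hbox s hs
    constructor
    · rintro ⟨h1, ⟨h2, h3, -⟩, h4⟩
      rw [hsec t h1, updatePair_apply_left hij, updatePair_apply_right] at h4
      omega
    · rintro ⟨h1, h2⟩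
      have h3 : t ≤ e := by omega
      refine ⟨h3, ⟨by omega, by omega, hs4⟩, ?_⟩
      rw [hsec t h3, updatePair_apply_left hij, updatePair_apply_right]
      omega

theorem card_diagonalSection_le (hij : i ≠ j) (hU : U ⊆ exponentBox D) (u : Fin n → ℕ) (e : ℕ) :
    (∀ t ∈ diagonalSection i j U u e, t ≤ min e (D i - 1)) ∧
    (diagonalSection i j U u e).card ≤ min e (D i - 1) + 1 := by
  have h : ∀ t ∈ diagonalSection i j U u e, t ≤ min e (D i - 1) := by
    intro t ht
    obtain ⟨h1, h2⟩ := mem_diagonalSection.1 ht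
    have := ((updatePair_mem_exponentBox hij).1 (hU h2)).1
    omega
  refine ⟨h, ?_⟩
  have : diagonalSection i j U u e ⊆ Finset.range (min e (D i - 1) + 1) := fun t ht => by
    rw [Finset.mem_range]
    have := h t ht
    omega
  simpa using Finset.card_le_card this

theorem card_diagonalSection_boxCompression (hij : i ≠ j) (hU : U ⊆ exponentBox D)
    (u : Fin n → ℕ) (e : ℕ) :
    (diagonalSection i j (boxCompression D i j U) u e).card =
      (diagonalSection i j U u e).card := by
  rw [diagonalSection_boxCompression hij hU, Nat.card_Ico]
  have := (card_diagonalSection_le hij hU u e).2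
  omega

/-- A sum over a subset of the box, computed diagonal by diagonal. -/
theorem sum_eq_sum_diagonalSection {M : Type*} [AddCommMonoid M] (hij : i ≠ j)
    (hU : U ⊆ exponentBox D) (f : (Fin n → ℕ) → M) :
    ∑ u ∈ U, f u =
      ∑ z ∈ (exponentBox D).image (fun u => updatePair i j u 0 (u i + u j)),
        ∑ t ∈ diagonalSection i j U z (z j), f (updatePair i j z t (z j - t)) := by
  rw [← Finset.sum_fiberwise_of_maps_to (t := (exponentBox D).image
    (fun u => updatePair i j u 0 (u i + u j))) (g := fun u => updatePair i j u 0 (u i + u j))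
    (fun u hu => Finset.mem_image_of_mem _ (hU hu))]
  refine Finset.sum_congr rfl fun z hz => ?_
  obtain ⟨w, -, hw⟩ := Finset.mem_image.1 hz
  have hzi : z i = 0 := by rw [← hw, updatePair_apply_left hij]
  have key : ∀ u, updatePair i j u 0 (u i + u j) = z →
      updatePair i j z (u i) (z j - u i) = u ∧ u i ≤ z j := by
    rintro u rfl
    rw [updatePair_apply_right, updatePair_updatePair, Nat.add_sub_cancel_left, updatePair_self]
    exact ⟨rfl, by omega⟩
  refine Finset.sum_nbij' (fun u => u i) (fun t => updatePair i j z t (z j - t)) ?_ ?_ ?_ ?_ ?_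
  · intro u hu
    obtain ⟨h1, h2⟩ := Finset.mem_filter.1 hu
    obtain ⟨h3, h4⟩ := key u h2
    exact mem_diagonalSection.2 ⟨h4, h3.symm ▸ h1⟩
  · intro t ht
    obtain ⟨h1, h2⟩ := mem_diagonalSection.1 ht
    refine Finset.mem_filter.2 ⟨h2, ?_⟩
    rw [updatePair_updatePair, updatePair_apply_left hij, updatePair_apply_right,
      Nat.add_sub_cancel' h1]
    conv_rhs => rw [← updatePair_self (i := i) (j := j) z, hzi]
  · intro u hu
    exact (key u (Finset.mem_filter.1 hu).2).1
  · intro t ht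
    exact updatePair_apply_left hij _ _ _
  · intro u hu
    rw [(key u (Finset.mem_filter.1 hu).2).1]

/-- This is where the order of the sides matters: as `D i ≤ D j`, no element of a diagonal
`u i + u j = e` with `e + 1 < D i` is at the boundary in direction `j`, so that the next diagonal
has at least one more element. -/
theorem IsBoxUpset.boxCompression (hij : i ≠ j) (hD : D i ≤ D j) (hU : IsBoxUpset D U) :
    IsBoxUpset D (boxCompression D i j U) := by
  refine .of_step (Finset.filter_subset _ _) fun u hu l hl => ?_
  obtain ⟨hub, huc⟩ := Finset.mem_filter.1 hu
  have hub' := mem_exponentBox.1 hub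
  have hbox : Function.update u l (u l + 1) ∈ exponentBox D := by
    rw [mem_exponentBox]
    intro l'
    by_cases h : l' = l
    · subst h; simpa using hl
    · simpa [h] using hub' l'
  refine Finset.mem_filter.2 ⟨hbox, ?_⟩
  set X := diagonalSection i j U u (u i + u j) with hX
  have hXm : ∀ t ∈ X, t ≤ u i + u j ∧ t < D i ∧ u i + u j - t < D j ∧
      updatePair i j u t (u i + u j - t) ∈ U := by
    intro t ht
    obtain ⟨h1, h2⟩ := mem_diagonalSection.1 ht
    have h3 := (updatePair_mem_exponentBox hij).1 (hU.1 h2)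
    exact ⟨h1, h3.1, h3.2.1, h2⟩
  have hXpos : X.Nonempty := Finset.card_pos.1 (by omega)
  by_cases hlij : l = i ∨ l = j
  · have hsec : diagonalSection i j U (Function.update u l (u l + 1)) (u i + u j + 1) =
        diagonalSection i j U u (u i + u j + 1) :=
      diagonalSection_congr (fun l' hi hj => by
        rcases hlij with rfl | rfl
        · exact Function.update_of_ne hi _ _
        · exact Function.update_of_ne hj _ _) _
    set Y := diagonalSection i j U u (u i + u j + 1) with hY
    have hY1 : ∀ t ∈ X, t + 1 < D i → t + 1 ∈ Y := by
      intro t ht hta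
      obtain ⟨h1, h2, h3, h4⟩ := hXm t ht
      refine mem_diagonalSection.2 ⟨by omega, hU.2 _ h4 _ ?_ ?_⟩
      · exact (updatePair_mem_exponentBox hij).2 ⟨hta, by omega, fun l _ _ => hub' l⟩
      · exact updatePair_mono (fun _ _ _ => le_rfl) (by omega) (by omega)
    have hY2 : ∀ t ∈ X, u i + u j + 1 < t + D j → t ∈ Y := by
      intro t ht hta
      obtain ⟨h1, h2, h3, h4⟩ := hXm t ht
      refine mem_diagonalSection.2 ⟨by omega, hU.2 _ h4 _ ?_ ?_⟩
      · exact (updatePair_mem_exponentBox hij).2 ⟨h2, by omega, fun l _ _ => hub' l⟩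
      · exact updatePair_mono (fun _ _ _ => le_rfl) (by omega) (by omega)
    have L1 := card_lt_card_diagonal hD (fun t ht => (hXm t ht).1) hY1 hY2 hXpos
    have L2 := card_le_card_diagonal (e := u i + u j) hY2
    have L3 := min_card_le_card_diagonal (fun t ht => by have := hXm t ht; omega) hY1 hY2
    have hui := hub' i
    have huj := hub' j
    rcases hlij with rfl | rfl
    · rw [Function.update_self, Function.update_of_ne hij.symm, add_right_comm, hsec]
      omega
    · rw [Function.update_self, Function.update_of_ne hij, ← add_assoc, hsec]
      omega
  · push Not at hlij
    rw [Function.update_of_ne hlij.1.symm, Function.update_of_ne hlij.2.symm]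
    refine huc.trans_le (Finset.card_le_card fun t ht => ?_)
    obtain ⟨h1, h2, h3, h4⟩ := hXm t ht
    refine mem_diagonalSection.2 ⟨h1, hU.2 _ h4 _ ?_ ?_⟩
    · exact (updatePair_mem_exponentBox hij).2 ⟨h2, h3, fun l _ _ => mem_exponentBox.1 hbox l⟩
    · refine updatePair_mono (fun l' _ _ => ?_) le_rfl le_rfl
      by_cases h : l' = l
      · subst h; simp
      · simp [h]

/-- Compression keeps the number of elements of each degree. -/
theorem card_filter_boxCompression (hij : i ≠ j) (hU : U ⊆ exponentBox D) (e : ℕ) :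
    ((boxCompression D i j U).filter fun u => ∑ l, u l = e).card =
      (U.filter fun u => ∑ l, u l = e).card := by
  rw [Finset.card_filter, Finset.card_filter, sum_eq_sum_diagonalSection hij hU,
    sum_eq_sum_diagonalSection hij (U := boxCompression D i j U) (Finset.filter_subset _ _)]
  refine Finset.sum_congr rfl fun z _ => ?_
  have key : ∀ V : Finset (Fin n → ℕ), ∑ t ∈ diagonalSection i j V z (z j),
      (if ∑ l, updatePair i j z t (z j - t) l = e then 1 else 0) =
      (diagonalSection i j V z (z j)).card *
        (if z j + ∑ l ∈ (Finset.univ.erase i).erase j, z l = e then 1 else 0) := by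
    intro V
    rw [← smul_eq_mul, ← Finset.sum_const]
    refine Finset.sum_congr rfl fun t ht => ?_
    have h1 := (mem_diagonalSection.1 ht).1
    have h2 := sum_updatePair hij (fun _ => 1) z t (z j - t)
    simp only [one_mul] at h2
    rw [h2, Nat.add_sub_cancel' h1]
  rw [key, key, card_diagonalSection_boxCompression hij hU]

/-- Compression in the directions `i < j` decreases the potential `∑ u ∈ U, ∑ l, l * u l`, unless
it does not change `U`. -/
theorem sum_boxCompression_lt (hij : i < j) (hU : U ⊆ exponentBox D)
    (hne : boxCompression D i j U ≠ U) :
    ∑ u ∈ boxCompression D i j U, ∑ l : Fin n, (l : ℕ) * u l < ∑ u ∈ U, ∑ l : Fin n, (l : ℕ) * u l := by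
  have hC : boxCompression D i j U ⊆ exponentBox D := Finset.filter_subset _ _
  rw [sum_eq_sum_diagonalSection hij.ne hU, sum_eq_sum_diagonalSection hij.ne hC]
  have key : ∀ z : Fin n → ℕ, diagonalSection i j U z (z j) ≠
      diagonalSection i j (boxCompression D i j U) z (z j) →
      ∑ t ∈ diagonalSection i j (boxCompression D i j U) z (z j),
        ∑ l : Fin n, (l : ℕ) * updatePair i j z t (z j - t) l <
      ∑ t ∈ diagonalSection i j U z (z j), ∑ l : Fin n, (l : ℕ) * updatePair i j z t (z j - t) l := by
    intro z hz
    rw [diagonalSection_boxCompression hij.ne hU] at hz ⊢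
    refine sum_Ico_lt_sum_of_ne (φ := fun t => ∑ l : Fin n, (l : ℕ) * updatePair i j z t (z j - t) l)
      (fun s t hst ht => ?_) (card_diagonalSection_le hij.ne hU z _).1 hz
    simp only [sum_updatePair hij.ne (fun l => (l : ℕ))]
    have hij' : (i : ℕ) < j := hij
    obtain ⟨c, hc⟩ := Nat.exists_eq_add_of_lt hst
    obtain ⟨y, hy⟩ := Nat.exists_eq_add_of_le (ht.trans (min_le_left _ _))
    have h1 : z j - t = y := by omega
    have h2 : z j - s = y + (c + 1) := by omega
    rw [h1, h2, hc]
    nlinarith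
  refine Finset.sum_lt_sum (fun z _ => ?_) ?_
  · by_cases hz : diagonalSection i j U z (z j) =
        diagonalSection i j (boxCompression D i j U) z (z j)
    · rw [hz]
    · exact (key z hz).le
  · by_contra hcon
    push Not at hcon
    refine hne (Finset.ext fun u => ?_)
    by_cases hub : u ∈ exponentBox D
    · have hz := hcon _ (Finset.mem_image_of_mem (fun u => updatePair i j u 0 (u i + u j)) hub)
      set z := updatePair i j u 0 (u i + u j) with hzdef
      have hsec : diagonalSection i j U z (z j) =
          diagonalSection i j (boxCompression D i j U) z (z j) := by
        by_contra h
        exact absurd (key z h) hz.not_gt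
      have hzj : z j = u i + u j := by rw [hzdef, updatePair_apply_right]
      have hmem : ∀ V : Finset (Fin n → ℕ), u i ∈ diagonalSection i j V z (z j) ↔ u ∈ V := by
        intro V
        rw [mem_diagonalSection, hzj, hzdef, updatePair_updatePair, Nat.add_sub_cancel_left,
          updatePair_self]
        simp
      rw [← hmem, ← hmem, hsec]
    · exact ⟨fun h => absurd (hC h) hub, fun h => absurd (hU h) hub⟩

/-- A compression that leaves `U` fixed witnesses stability of `U` in its two directions. -/
theorem boxCompression_ne_of_not_stable (hij : i ≠ j) {u : Fin n → ℕ} (hu : u ∈ U)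
    (hpos : 0 < u j) (hi : u i + 1 < D i)
    (hnot : updatePair i j u (u i + 1) (u j - 1) ∉ U) : boxCompression D i j U ≠ U := by
  intro hCU
  apply hnot
  have huC := hu
  rw [← hCU] at huC ⊢
  obtain ⟨hub, huc⟩ := Finset.mem_filter.1 huC
  have hub' := mem_exponentBox.1 hub
  refine Finset.mem_filter.2 ⟨(updatePair_mem_exponentBox hij).2
    ⟨hi, by have := hub' j; omega, fun l _ _ => hub' l⟩, ?_⟩
  rw [updatePair_apply_left hij, updatePair_apply_right,
    show u i + 1 + (u j - 1) = u i + u j by omega,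
    diagonalSection_congr (v := u) (fun l hi hj => updatePair_apply_of_ne hi hj _ _ _)]
  omega

/-- Every upset of the box has the degree profile of a strongly stable upset, provided the sides
of the box are in increasing order. -/
theorem exists_isBoxStable (hD : Monotone D) (hU : IsBoxUpset D U) :
    ∃ V, IsBoxUpset D V ∧ IsBoxStable D V ∧
      ∀ e, (V.filter fun u => ∑ l, u l = e).card = (U.filter fun u => ∑ l, u l = e).card := by
  obtain ⟨N, hN⟩ : ∃ N, ∑ u ∈ U, ∑ l : Fin n, (l : ℕ) * u l = N := ⟨_, rfl⟩
  induction N using Nat.strong_induction_on generalizing U with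
  | _ N ih =>
    by_cases hst : IsBoxStable D U
    · exact ⟨U, hU, hst, fun _ => rfl⟩
    · simp only [IsBoxStable, not_forall] at hst
      obtain ⟨u, hu, i, j, hij, hpos, hi, hnot⟩ := hst
      have hlt := sum_boxCompression_lt hij hU.1
        (boxCompression_ne_of_not_stable hij.ne hu hpos hi hnot)
      obtain ⟨V, h1, h2, h3⟩ := ih _ (hN ▸ hlt) (hU.boxCompression hij.ne (hD hij.le)) rfl
      exact ⟨V, h1, h2, fun e => by rw [h3, card_filter_boxCompression hij.ne hU.1]⟩

end Compression

/-! ### The smallest upsets with a given number of elements of small degree -/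

section UpsetSize

variable {n : ℕ} {D : Fin n → ℕ} {U : Finset (Fin n → ℕ)} {a x : Fin n → ℕ} {k p : Fin n}

/-- The elements of the box above `x`. -/
def boxAbove {n : ℕ} (D x : Fin n → ℕ) : Finset (Fin n → ℕ) :=
  Fintype.piFinset fun i => Finset.Ico (x i) (D i)

/-- The elements of the box that agree with `x` in the coordinates `i` with `i < t`. -/
def boxCylinder {n : ℕ} (D x : Fin n → ℕ) (t : ℕ) : Finset (Fin n → ℕ) :=
  Fintype.piFinset fun i => if (i : ℕ) < t then {x i} else Finset.range (D i)

theorem mem_boxAbove {v : Fin n → ℕ} : v ∈ boxAbove D x ↔ x ≤ v ∧ v ∈ exponentBox D := by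
  simp only [boxAbove, Fintype.mem_piFinset, Finset.mem_Ico, mem_exponentBox, Pi.le_def]
  exact forall_and

theorem card_boxAbove : (boxAbove D x).card = ∏ i, (D i - x i) := by
  simp [boxAbove, Fintype.card_piFinset]

theorem mem_boxCylinder (hx : x ∈ exponentBox D) {t : ℕ} {v : Fin n → ℕ} :
    v ∈ boxCylinder D x t ↔ (∀ i : Fin n, (i : ℕ) < t → v i = x i) ∧ v ∈ exponentBox D := by
  simp only [boxCylinder, Fintype.mem_piFinset, mem_exponentBox] at *
  constructor
  · refine fun h => ⟨fun i hi => by simpa [hi] using h i, fun i => ?_⟩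
    by_cases hi : (i : ℕ) < t
    · have : v i = x i := by simpa [hi] using h i
      exact this ▸ hx i
    · simpa [hi] using h i
  · rintro ⟨h1, h2⟩ i
    by_cases hi : (i : ℕ) < t
    · simpa [hi] using h1 i hi
    · simpa [hi] using h2 i

theorem card_boxCylinder (D x : Fin n → ℕ) (t : ℕ) :
    (boxCylinder D x t).card = ∏ i ∈ {i : Fin n | t ≤ (i : ℕ)}, D i := by
  rw [boxCylinder, Fintype.card_piFinset, Finset.prod_filter]
  refine Finset.prod_congr rfl fun i _ => ?_
  by_cases hi : (i : ℕ) < t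
  · simp [hi]
  · simp [hi]

theorem isBoxUpset_boxAbove : IsBoxUpset D (boxAbove D x) :=
  ⟨fun _ hv => (mem_boxAbove.1 hv).2,
    fun _ hu _ hv huv => mem_boxAbove.2 ⟨(mem_boxAbove.1 hu).1.trans huv, hv⟩⟩

theorem IsBoxUpset.boxAbove_subset (hU : IsBoxUpset D U) (hx : x ∈ U) : boxAbove D x ⊆ U :=
  fun v hv => hU.2 x hx v (mem_boxAbove.1 hv).2 (mem_boxAbove.1 hv).1

theorem eq_of_le_of_sum_eq {u v : Fin n → ℕ} (h : u ≤ v) (hs : ∑ i, u i = ∑ i, v i) : u = v :=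
  funext fun i => (Finset.sum_eq_sum_iff_of_le fun i _ => h i).1 hs i (Finset.mem_univ i)

theorem IsBoxUpset.exists_sum_eq (hU : IsBoxUpset D U) (ha : a ∈ exponentBox D) (hx : x ∈ U)
    (hxa : ∑ i, x i ≤ ∑ i, a i) : ∃ v ∈ U, ∑ i, v i = ∑ i, a i := by
  obtain ⟨N, hN⟩ := Nat.exists_eq_add_of_le hxa
  induction N generalizing x with
  | zero => exact ⟨x, hx, hN.symm⟩
  | succ N ih =>
    obtain ⟨i, -, hi⟩ : ∃ i ∈ Finset.univ, x i < a i :=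
      Finset.exists_lt_of_sum_lt (by omega)
    have hai := mem_exponentBox.1 ha i
    have hsum : ∑ l, Function.update x i (x i + 1) l = ∑ l, x l + 1 := by
      rw [Finset.sum_update_of_mem (Finset.mem_univ i),
        ← Finset.add_sum_erase _ _ (Finset.mem_univ i), Finset.sdiff_singleton_eq_erase]
      omega
    refine ih (x := Function.update x i (x i + 1)) (hU.2 x hx _ ?_ ?_) ?_ ?_
    · rw [mem_exponentBox]
      intro l
      by_cases hl : l = i
      · subst hl; simp; omega
      · simpa [hl] using mem_exponentBox.1 (hU.1 hx) l
    · intro l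
      by_cases hl : l = i
      · subst hl; simp
      · simp [hl]
    · omega
    · omega

/-- The exponent vector `a` is the first one of its degree in the lexicographic order: it is
maximal in the coordinates before `k` and vanishes in those after `k`. It is assumed not to be
maximal at `k`, so that `a` can be increased there. -/
structure IsLexFirst {n : ℕ} (D : Fin n → ℕ) (k : Fin n) (a : Fin n → ℕ) : Prop where
  add_one_eq : ∀ i < k, a i + 1 = D i
  add_one_lt : a k + 1 < D k
  eq_zero : ∀ i, k < i → a i = 0

theorem IsLexFirst.mem_box (ha : IsLexFirst D k a) (hD : ∀ i, 0 < D i) :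
    a ∈ exponentBox D := by
  rw [mem_exponentBox]
  intro i
  rcases lt_trichotomy i k with h | rfl | h
  · have := ha.add_one_eq i h
    omega
  · have := ha.add_one_lt
    omega
  · rw [ha.eq_zero i h]
    exact hD i

/-- A strongly stable set contains the lexicographically first exponent vector of every degree
that occurs in it. -/
theorem IsBoxStable.mem_of_isLexFirst (hst : IsBoxStable D U) (hU : U ⊆ exponentBox D)
    (hD : ∀ i, 0 < D i) (ha : IsLexFirst D k a) (hx : x ∈ U) (hxa : ∑ i, x i = ∑ i, a i) :
    a ∈ U := by
  obtain ⟨u, hu, hmin⟩ := Finset.exists_min_image (U.filter fun u => ∑ i, u i = ∑ i, a i)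
    (fun u => ∑ l : Fin n, (l : ℕ) * u l) ⟨x, Finset.mem_filter.2 ⟨hx, hxa⟩⟩
  obtain ⟨huU, hus⟩ := Finset.mem_filter.1 hu
  suffices u = a from this ▸ huU
  by_contra hne
  obtain ⟨q, hq⟩ := Function.ne_iff.1 hne
  obtain ⟨p, hp, hpmin⟩ := Finset.exists_min_image (Finset.univ.filter fun p => u p ≠ a p) id
    ⟨q, by simpa using hq⟩
  simp only [Finset.mem_filter, Finset.mem_univ, true_and, id] at hp hpmin
  have hbefore : ∀ l < p, u l = a l := fun l hl => by
    by_contra h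
    exact absurd (hpmin l h) (not_le.2 hl)
  have hab := mem_exponentBox.1 (ha.mem_box hD)
  have hub := mem_exponentBox.1 (hU huU)
  rcases lt_or_gt_of_ne hp with h | h
  · have hzero : ∀ j, p < j → u j = 0 := by
      intro j hj
      by_contra hpos
      have hi : u p + 1 < D p := by have := hab p; omega
      have hmove := hst u huU p j hj (by omega) hi
      have h1 := sum_updatePair hj.ne (fun _ => 1) u (u p + 1) (u j - 1)
      have h2 := sum_updatePair hj.ne (fun _ => 1) u (u p) (u j)
      have h3 := sum_updatePair hj.ne (fun l => (l : ℕ)) u (u p + 1) (u j - 1)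
      have h4 := sum_updatePair hj.ne (fun l => (l : ℕ)) u (u p) (u j)
      rw [updatePair_self] at h2 h4
      simp only [one_mul] at h1 h2
      have h5 := hmin _ (Finset.mem_filter.2 ⟨hmove, by omega⟩)
      obtain ⟨c, hc⟩ : ∃ c, u j = c + 1 := ⟨u j - 1, by omega⟩
      have hj' : (p : ℕ) < j := hj
      rw [h3, h4, hc, Nat.add_sub_cancel] at h5
      nlinarith
    refine hne (eq_of_le_of_sum_eq (fun l => ?_) hus)
    rcases lt_trichotomy l p with hl | rfl | hl
    · exact (hbefore l hl).le
    · exact h.le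
    · exact (hzero l hl).le.trans (Nat.zero_le _)
  · have hkp : k ≤ p := by
      by_contra hlt
      have := ha.add_one_eq p (not_le.1 hlt)
      have := hub p
      omega
    refine hne (eq_of_le_of_sum_eq (fun l => ?_) hus.symm).symm
    rcases lt_trichotomy l p with hl | rfl | hl
    · exact (hbefore l hl).ge
    · exact h.le
    · exact (ha.eq_zero l (hkp.trans_lt hl)).le.trans (Nat.zero_le _)

theorem card_eq_of_profile_eq {V : Finset (Fin n → ℕ)}
    (h : ∀ e, (V.filter fun u => ∑ l, u l = e).card = (U.filter fun u => ∑ l, u l = e).card) :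
    V.card = U.card := by
  rw [Finset.card_eq_sum_card_image (fun u => ∑ l, u l) V,
    Finset.card_eq_sum_card_fiberwise (f := fun u => ∑ l, u l)
      (t := V.image fun u => ∑ l, u l) (s := U)]
  · exact Finset.sum_congr rfl fun e _ => h e
  · intro u hu
    have hpos : 0 < (U.filter fun v => ∑ l, v l = ∑ l, u l).card :=
      Finset.card_pos.2 ⟨u, Finset.mem_filter.2 ⟨hu, rfl⟩⟩
    rw [← h] at hpos
    obtain ⟨v, hv⟩ := Finset.card_pos.1 hpos
    obtain ⟨hv1, hv2⟩ := Finset.mem_filter.1 hv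
    exact Finset.mem_coe.2 (Finset.mem_image.2 ⟨v, hv1, hv2⟩)

/-- The number of elements above an exponent vector of a given degree is smallest for the
lexicographically first one. -/
theorem IsLexFirst.prod_sub_le (hmono : Monotone D) (hD : ∀ i, 0 < D i) (ha : IsLexFirst D k a)
    (hx : x ∈ exponentBox D) (hxa : ∑ i, x i ≤ ∑ i, a i) :
    ∏ i, (D i - a i) ≤ ∏ i, (D i - x i) := by
  obtain ⟨V, hV, hst, hprof⟩ := exists_isBoxStable hmono (isBoxUpset_boxAbove (D := D) (x := x))
  have hpos : 0 < ((boxAbove D x).filter fun v => ∑ l, v l = ∑ l, x l).card :=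
    Finset.card_pos.2 ⟨x, Finset.mem_filter.2 ⟨mem_boxAbove.2 ⟨le_rfl, hx⟩, rfl⟩⟩
  rw [← hprof] at hpos
  obtain ⟨v, hv⟩ := Finset.card_pos.1 hpos
  obtain ⟨hv1, hv2⟩ := Finset.mem_filter.1 hv
  obtain ⟨w, hw, hws⟩ := hV.exists_sum_eq (ha.mem_box hD) hv1 (hv2 ▸ hxa)
  have haV := hst.mem_of_isLexFirst hV.1 hD ha hw hws
  rw [← card_boxAbove, ← card_boxAbove, ← card_eq_of_profile_eq hprof]
  exact Finset.card_le_card (hV.boxAbove_subset haV)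

/-- If `p` is the last coordinate at which `w` is nonzero, then all elements strictly above
`w - e_p` belong to a stable upset containing `w`, apart from those which exceed `w - e_p` only
in coordinates after `p`. -/
theorem IsBoxStable.boxAbove_sdiff_subset (hst : IsBoxStable D U) (hU : IsBoxUpset D U)
    {w : Fin n → ℕ} (hw : w ∈ U) (hp : 0 < w p) :
    boxAbove D (Function.update w p (w p - 1)) \
      boxCylinder D (Function.update w p (w p - 1)) (p + 1) ⊆ U := by
  intro v hv
  obtain ⟨hv1, hv2⟩ := Finset.mem_sdiff.1 hv
  obtain ⟨hle, hvb⟩ := mem_boxAbove.1 hv1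
  have hvb' := mem_exponentBox.1 hvb
  have hxb : Function.update w p (w p - 1) ∈ exponentBox D :=
    mem_exponentBox.2 fun i => (hle i).trans_lt (hvb' i)
  rw [mem_boxCylinder hxb] at hv2
  obtain ⟨i, hip, hi⟩ : ∃ i ≤ p, v i ≠ Function.update w p (w p - 1) i := by
    by_contra hcon
    push Not at hcon
    exact hv2 ⟨fun i hi => hcon i (Fin.le_def.2 (by omega)), hvb⟩
  have hlt : Function.update w p (w p - 1) i < v i := lt_of_le_of_ne (hle i) hi.symm
  rcases hip.eq_or_lt with rfl | hip
  · refine hU.2 w hw v hvb fun l => ?_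
    by_cases hl : l = i
    · subst hl
      rw [Function.update_self] at hlt
      show w l ≤ v l
      omega
    · simpa [hl] using hle l
  · rw [Function.update_of_ne hip.ne] at hlt
    have hmove := hst w hw i p hip hp (by have := hvb' i; omega)
    refine hU.2 _ hmove v hvb fun l => ?_
    have hl := hle l
    by_cases hlp : l = p
    · subst hlp
      rw [Function.update_self] at hl
      rwa [updatePair_apply_right]
    · rw [Function.update_of_ne hlp] at hl
      by_cases hli : l = i
      · subst hli
        rwa [updatePair_apply_left hip.ne]
      · rwa [updatePair_apply_of_ne hli hlp]

/-- An upset of the box with at least `r ≥ 1` elements of degree at most `∑ a + 1` is at least as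
large as the one generated by the covers of the lexicographically first vector `a` in the
coordinates `k, …, k + r - 1`. -/
theorem IsLexFirst.prod_sub_le_card_add (hmono : Monotone D) (hD : ∀ i, 0 < D i)
    (ha : IsLexFirst D k a) (hU : IsBoxUpset D U) {r : ℕ} (hr : 1 ≤ r)
    (hcard : r ≤ (U.filter fun u => ∑ i, u i ≤ ∑ i, a i + 1).card) :
    ∏ i, (D i - a i) ≤ U.card + ∏ i ∈ {i : Fin n | (k : ℕ) + r ≤ (i : ℕ)}, D i := by
  by_cases hlow : ∃ u ∈ U, ∑ i, u i ≤ ∑ i, a i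
  · obtain ⟨u, hu, hus⟩ := hlow
    refine (ha.prod_sub_le hmono hD (hU.1 hu) hus).trans ?_
    rw [← card_boxAbove]
    exact (Finset.card_le_card (hU.boxAbove_subset hu)).trans (Nat.le_add_right _ _)
  push Not at hlow
  obtain ⟨V, hV, hst, hprof⟩ := exists_isBoxStable hmono hU
  rw [← card_eq_of_profile_eq hprof]
  set T := V.filter fun u => ∑ i, u i = ∑ i, a i + 1 with hT
  have hrT : r ≤ T.card := by
    rw [hT, hprof]
    refine hcard.trans (Finset.card_le_card fun u hu => ?_)
    obtain ⟨h1, h2⟩ := Finset.mem_filter.1 hu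
    have := hlow u h1
    exact Finset.mem_filter.2 ⟨h1, by omega⟩
  have hlast : ∀ w : Fin n → ℕ, ∃ p : Fin n, w ∈ T → 0 < w p ∧ (∀ i, p < i → w i = 0) ∧ k ≤ p := by
    intro w
    by_cases hw : w ∈ T
    · obtain ⟨hwV, hws⟩ := Finset.mem_filter.1 hw
      obtain ⟨q, -, hq⟩ : ∃ q ∈ Finset.univ, w q ≠ 0 :=
        Finset.exists_ne_zero_of_sum_ne_zero (by omega)
      obtain ⟨p, hp, hpmax⟩ := Finset.exists_max_image (Finset.univ.filter fun p => w p ≠ 0) id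
        ⟨q, by simpa using hq⟩
      simp only [Finset.mem_filter, Finset.mem_univ, true_and, id] at hp hpmax
      have hzero : ∀ i, p < i → w i = 0 := fun i hi => by
        by_contra h
        exact absurd (hpmax i h) (not_le.2 hi)
      refine ⟨p, fun _ => ⟨Nat.pos_of_ne_zero hp, hzero, ?_⟩⟩
      by_contra hpk
      rw [not_le] at hpk
      have hle : ∑ i, w i ≤ ∑ i, a i := by
        refine Finset.sum_le_sum fun i _ => ?_
        rcases lt_or_ge i k with h | h
        · have h1 := ha.add_one_eq i h
          have h2 := mem_exponentBox.1 (hV.1 hwV) i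
          omega
        · rw [hzero i (hpk.trans_le h)]
          exact Nat.zero_le _
      omega
    · exact ⟨k, fun h => absurd h hw⟩
  choose last hlast using hlast
  have hlower : ∀ w ∈ T, ∏ i, (D i - a i) ≤
      (boxAbove D (Function.update w (last w) (w (last w) - 1))).card := by
    intro w hw
    obtain ⟨hwV, hws⟩ := Finset.mem_filter.1 hw
    have hpos := (hlast w hw).1
    have hwb := mem_exponentBox.1 (hV.1 hwV)
    rw [card_boxAbove]
    refine ha.prod_sub_le hmono hD (mem_exponentBox.2 fun i => ?_) ?_
    · by_cases hi : i = last w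
      · rw [hi, Function.update_self]
        have := hwb (last w)
        omega
      · rw [Function.update_of_ne hi]
        exact hwb i
    · have h1 := Finset.add_sum_erase _ w (Finset.mem_univ (last w))
      rw [Finset.sum_update_of_mem (Finset.mem_univ (last w)), Finset.sdiff_singleton_eq_erase]
      omega
  obtain ⟨w₀, hw₀, hmax⟩ := Finset.exists_max_image T last (Finset.card_pos.1 (by omega))
  rcases Nat.lt_or_ge (last w₀ : ℕ) ((k : ℕ) + r - 1) with hm | hm
  · -- The last nonzero coordinates take fewer than `r` values, so two of them coincide.
    have hpig : (Finset.Icc k (last w₀)).card < T.card := by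
      rw [Fin.card_Icc]
      have : (k : ℕ) ≤ last w₀ := (hlast w₀ hw₀).2.2
      omega
    obtain ⟨w, hw, w', hw', hne, heq⟩ : ∃ w ∈ T, ∃ w' ∈ T, w ≠ w' ∧ last w = last w' :=
      Finset.exists_ne_map_eq_of_card_lt_of_maps_to hpig fun w hw =>
        Finset.mem_coe.2 (Finset.mem_Icc.2 ⟨(hlast w hw).2.2, hmax w hw⟩)
    obtain ⟨w, hw, w', hw', hne, heq, hle⟩ : ∃ w ∈ T, ∃ w' ∈ T, w ≠ w' ∧ last w = last w' ∧
        w (last w) ≤ w' (last w) := by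
      rcases le_total (w (last w)) (w' (last w)) with h | h
      · exact ⟨w, hw, w', hw', hne, heq, h⟩
      · exact ⟨w', hw', w, hw, hne.symm, heq.symm, heq ▸ h⟩
    set p := last w with hp
    obtain ⟨hwV, hws⟩ := Finset.mem_filter.1 hw
    obtain ⟨hwV', hws'⟩ := Finset.mem_filter.1 hw'
    obtain ⟨hpos, hzero, -⟩ := hlast w hw
    obtain ⟨hpos', hzero', -⟩ := hlast w' hw'
    rw [← heq] at hpos' hzero'
    rw [← hp] at hpos hzero
    set y := Function.update w p (w p - 1) with hy
    have hdisj : Disjoint (boxAbove D y \ boxCylinder D y (p + 1)) (boxCylinder D w' (p + 1)) := by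
      rw [Finset.disjoint_left]
      intro v hv hv'
      rw [mem_boxCylinder (hV.1 hwV')] at hv'
      have hyv := (mem_boxAbove.1 (Finset.mem_sdiff.1 hv).1).1
      refine hne (eq_of_le_of_sum_eq (fun i => ?_) (hws.trans hws'.symm))
      rcases lt_trichotomy i p with hi | rfl | hi
      · have h1 := hyv i
        rw [hy, Function.update_of_ne hi.ne, hv'.1 i (by have : (i : ℕ) < p := hi; omega)] at h1
        exact h1
      · exact hle
      · rw [hzero i hi]
        exact Nat.zero_le _
    have hsub : (boxAbove D y \ boxCylinder D y (p + 1)) ∪ boxCylinder D w' (p + 1) ⊆ V := by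
      refine Finset.union_subset (hst.boxAbove_sdiff_subset hV hwV hpos) fun v hv => ?_
      rw [mem_boxCylinder (hV.1 hwV')] at hv
      refine hV.2 w' hwV' v hv.2 fun i => ?_
      rcases lt_or_ge p i with hi | hi
      · rw [hzero' i hi]
        exact Nat.zero_le _
      · exact (hv.1 i (by have : (i : ℕ) ≤ p := hi; omega)).ge
    have h1 := Finset.card_le_card hsub
    have h2 := Finset.le_card_sdiff (boxCylinder D y (p + 1)) (boxAbove D y)
    rw [Finset.card_union_of_disjoint hdisj, card_boxCylinder] at h1
    rw [card_boxCylinder] at h2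
    have h3 := hlower w hw
    rw [← hp, ← hy] at h3
    omega
  · obtain ⟨hwV, hws⟩ := Finset.mem_filter.1 hw₀
    have h1 := Finset.card_le_card (hst.boxAbove_sdiff_subset hV hwV (hlast w₀ hw₀).1)
    have h2 := Finset.le_card_sdiff
      (boxCylinder D (Function.update w₀ (last w₀) (w₀ (last w₀) - 1)) (last w₀ + 1))
      (boxAbove D (Function.update w₀ (last w₀) (w₀ (last w₀) - 1)))
    rw [card_boxCylinder] at h2
    have h3 := hlower w₀ hw₀
    have h4 : ∏ i ∈ {i : Fin n | (last w₀ : ℕ) + 1 ≤ (i : ℕ)}, D i ≤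
        ∏ i ∈ {i : Fin n | (k : ℕ) + r ≤ (i : ℕ)}, D i := by
      refine Finset.prod_le_prod_of_subset_of_one_le' (fun i hi => ?_) fun i _ _ => hD i
      simp only [Finset.mem_filter, Finset.mem_univ, true_and] at hi ⊢
      omega
    omega

end UpsetSize

/-! ### Leading indices of a subspace -/

section LeadingIndices

variable {K V ι Λ : Type*} [Field K] [AddCommGroup V] [Module K V] [Fintype ι] [LinearOrder Λ]

/-- The indices of the leading terms of the elements of a subspace `W`, with respect to a basis
whose index set is ordered through `o`. -/
def leadingIndices (b : Module.Basis ι K V) (o : ι → Λ) (W : Submodule K V) : Set ι :=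
  {u | ∃ f ∈ W, b.repr f u ≠ 0 ∧ ∀ v, o u < o v → b.repr f v = 0}

theorem finrank_le_ncard_leadingIndices (b : Module.Basis ι K V) (o : ι → Λ)
    (W : Submodule K V) :
    Module.finrank K W ≤ (leadingIndices b o W).ncard := by
  classical
  let φ : W →ₗ[K] (leadingIndices b o W → K) :=
    LinearMap.pi fun u => (b.coord u.1).comp W.subtype
  have hφ : Function.Injective φ := by
    rw [← LinearMap.ker_eq_bot, LinearMap.ker_eq_bot']
    intro f hf
    by_contra hne
    have hrepr : (b.repr (f : V)).support.Nonempty := by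
      rw [Finsupp.support_nonempty_iff]
      intro h
      exact hne (Subtype.ext (by simpa using h))
    obtain ⟨u, hu, hmax⟩ := Finset.exists_max_image _ o hrepr
    have hlead : u ∈ leadingIndices b o W := by
      refine ⟨f, f.2, Finsupp.mem_support_iff.1 hu, fun v hv => ?_⟩
      by_contra h
      exact absurd (hmax v (Finsupp.mem_support_iff.2 h)) (not_le.2 hv)
    exact Finsupp.mem_support_iff.1 hu (congrFun hf ⟨u, hlead⟩)
  have h := LinearMap.finrank_le_finrank_of_injective hφ
  rwa [Module.finrank_fintype_fun_eq_card, ← Nat.card_eq_fintype_card, Nat.card_coe_set_eq] at h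

theorem ncard_leadingIndices_le_finrank (b : Module.Basis ι K V) {o : ι → Λ}
    (ho : Function.Injective o) (W : Submodule K V) :
    (leadingIndices b o W).ncard ≤ Module.finrank K W := by
  classical
  have : Module.Finite K V := Module.Finite.of_basis b
  choose f hfW hf0 hfv using fun u : leadingIndices b o W => u.2
  have hli : LinearIndependent K fun u => (⟨f u, hfW u⟩ : W) := by
    rw [Fintype.linearIndependent_iff]
    intro c hc
    by_contra hcon
    push Not at hcon
    obtain ⟨u₀, hu₀⟩ := hcon
    obtain ⟨u, hu, hmax⟩ := Finset.exists_max_image (Finset.univ.filter fun u => c u ≠ 0)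
      (fun u => o u.1) ⟨u₀, by simpa using hu₀⟩
    simp only [Finset.mem_filter, Finset.mem_univ, true_and] at hu hmax
    have h1 := congrArg (fun w : W => b.repr (w : V) u) hc
    simp only [Submodule.coe_sum, Submodule.coe_smul, map_sum, map_smul, Finsupp.coe_finsetSum,
      Finset.sum_apply, Finsupp.smul_apply, smul_eq_mul, ZeroMemClass.coe_zero, map_zero,
      Finsupp.zero_apply] at h1
    rw [Finset.sum_eq_single u] at h1
    · exact (mul_ne_zero hu (hf0 u)) h1
    · intro v _ hv
      by_cases hcv : c v = 0
      · rw [hcv, zero_mul]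
      · have hlt : o v.1 < o u.1 :=
          lt_of_le_of_ne (hmax v hcv) fun h => hv (Subtype.ext (ho h))
        rw [hfv v u hlt, mul_zero]
    · exact fun h => absurd (Finset.mem_univ u) h
  have h := hli.fintype_card_le_finrank
  rwa [← Nat.card_eq_fintype_card, Nat.card_coe_set_eq] at h

end LeadingIndices

/-! ### Newton functions on a grid and the footprint bound -/

section Newton

variable {K : Type*} [Field K] {n : ℕ} {a : Fin n → ℕ → K} {D : Fin n → ℕ}

/-- The value of the Newton polynomial `∏ i, ∏ t < u i, (x_i - a i t)` at the grid point
`(a i (v i))_i`. -/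
def newtonFun (a : Fin n → ℕ → K) (u v : Fin n → ℕ) : K :=
  ∏ i, ∏ t ∈ Finset.range (u i), (a i (v i) - a i t)

theorem newtonFun_ne_zero_iff (ha : ∀ i, Set.InjOn (a i) (Set.Iio (D i))) {u v : Fin n → ℕ}
    (hv : v ∈ exponentBox D) : newtonFun a u v ≠ 0 ↔ u ≤ v := by
  simp only [newtonFun, Finset.prod_ne_zero_iff, Finset.mem_univ, true_imp_iff, Finset.mem_range,
    sub_ne_zero, Pi.le_def]
  refine forall_congr' fun i => ⟨fun h => ?_, fun h t ht heq => ?_⟩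
  · by_contra hlt
    exact h (v i) (not_le.1 hlt) rfl
  · have hvi := mem_exponentBox.1 hv i
    have := ha i hvi (show t < D i by omega) heq
    omega

theorem newtonFun_succ (u v : Fin n → ℕ) (i : Fin n) :
    newtonFun a (Function.update u i (u i + 1)) v =
      (a i (v i) - a i (u i)) * newtonFun a u v := by
  unfold newtonFun
  rw [← Finset.mul_prod_erase _ _ (Finset.mem_univ i),
    ← Finset.mul_prod_erase _ (fun i => ∏ t ∈ Finset.range (u i), (a i (v i) - a i t))
      (Finset.mem_univ i), Function.update_self, Finset.prod_range_succ, ← mul_assoc,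
    mul_comm (a i (v i) - a i (u i))]
  congr 1
  refine Finset.prod_congr rfl fun l hl => ?_
  rw [Function.update_of_ne (Finset.ne_of_mem_erase hl)]

theorem linearIndependent_newtonFun (ha : ∀ i, Set.InjOn (a i) (Set.Iio (D i))) :
    LinearIndependent K fun (u v : exponentBox D) => newtonFun a u v := by
  classical
  rw [Fintype.linearIndependent_iff]
  intro c hc
  by_contra hcon
  push Not at hcon
  obtain ⟨u₀, hu₀⟩ := hcon
  obtain ⟨u, hu, hmin⟩ := Finset.exists_min_image (Finset.univ.filter fun u => c u ≠ 0)
    (fun u => ∑ i, u.1 i) ⟨u₀, by simpa using hu₀⟩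
  simp only [Finset.mem_filter, Finset.mem_univ, true_and] at hu hmin
  have h1 := congrFun hc u
  simp only [Finset.sum_apply, Pi.smul_apply, smul_eq_mul, Pi.zero_apply] at h1
  rw [Finset.sum_eq_single u] at h1
  · exact mul_ne_zero hu ((newtonFun_ne_zero_iff ha u.2).2 le_rfl) h1
  · intro v _ hv
    by_cases hcv : c v = 0
    · rw [hcv, zero_mul]
    · by_cases hle : v.1 ≤ u.1
      · exact absurd (Subtype.ext (eq_of_le_of_sum_eq hle
          (le_antisymm (Finset.sum_le_sum fun i _ => hle i) (hmin v hcv)))) hv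
      · rw [not_ne_iff.1 (mt (newtonFun_ne_zero_iff ha u.2).1 hle), mul_zero]
  · exact fun h => absurd (Finset.mem_univ u) h

/-- The Newton functions form a basis of the space of functions on the grid. -/
noncomputable def newtonBasis (ha : ∀ i, Set.InjOn (a i) (Set.Iio (D i))) :
    Module.Basis (exponentBox D) K (exponentBox D → K) :=
  .mk (linearIndependent_newtonFun ha)
    ((linearIndependent_newtonFun ha).span_eq_top_of_card_eq_finrank'
      (Module.finrank_fintype_fun_eq_card K).symm).ge

theorem newtonBasis_apply (ha : ∀ i, Set.InjOn (a i) (Set.Iio (D i))) (u v : exponentBox D) :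
    newtonBasis ha u v = newtonFun a u v := by
  rw [newtonBasis, Module.Basis.mk_apply]

/-- Multiplication of functions on the grid by the `i`-th coordinate. -/
def mulCoord (a : Fin n → ℕ → K) (D : Fin n → ℕ) (i : Fin n) :
    (exponentBox D → K) →ₗ[K] (exponentBox D → K) :=
  LinearMap.mulLeft K fun v => a i (v.1 i)

theorem mulCoord_newtonBasis (ha : ∀ i, Set.InjOn (a i) (Set.Iio (D i))) (i : Fin n)
    (u : exponentBox D) :
    mulCoord a D i (newtonBasis ha u) = (fun v : exponentBox D =>
      newtonFun a (Function.update u.1 i (u.1 i + 1)) v) + a i (u.1 i) • newtonBasis ha u := by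
  funext v
  simp only [mulCoord, LinearMap.mulLeft_apply, Pi.mul_apply, Pi.add_apply, Pi.smul_apply,
    smul_eq_mul, newtonBasis_apply, newtonFun_succ]
  ring

theorem mulCoord_newtonBasis_of_mem (ha : ∀ i, Set.InjOn (a i) (Set.Iio (D i))) (i : Fin n)
    {u w : exponentBox D} (hw : w.1 = Function.update u.1 i (u.1 i + 1)) :
    mulCoord a D i (newtonBasis ha u) = newtonBasis ha w + a i (u.1 i) • newtonBasis ha u := by
  rw [mulCoord_newtonBasis]
  congr 1
  funext v
  rw [newtonBasis_apply, hw]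

theorem mulCoord_newtonBasis_of_notMem (ha : ∀ i, Set.InjOn (a i) (Set.Iio (D i))) (i : Fin n)
    {u : exponentBox D} (hu : Function.update u.1 i (u.1 i + 1) ∉ exponentBox D) :
    mulCoord a D i (newtonBasis ha u) = a i (u.1 i) • newtonBasis ha u := by
  rw [mulCoord_newtonBasis, add_eq_right]
  funext v
  by_contra h
  have hle := (newtonFun_ne_zero_iff ha v.2).1 h
  exact hu (mem_exponentBox.2 fun l => (hle l).trans_lt (mem_exponentBox.1 v.2 l))

theorem repr_mulCoord_newtonBasis (ha : ∀ i, Set.InjOn (a i) (Set.Iio (D i))) (i : Fin n)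
    {u w : exponentBox D} (hne : w ≠ u) :
    (newtonBasis ha).repr (mulCoord a D i (newtonBasis ha u)) w =
      if w.1 = Function.update u.1 i (u.1 i + 1) then 1 else 0 := by
  by_cases hu : Function.update u.1 i (u.1 i + 1) ∈ exponentBox D
  · rw [mulCoord_newtonBasis_of_mem ha i (w := ⟨_, hu⟩) rfl]
    simp only [map_add, map_smul, Module.Basis.repr_self, Finsupp.add_apply, Finsupp.smul_apply,
      Finsupp.single_apply, smul_eq_mul, hne.symm, if_false, mul_zero, add_zero, Subtype.ext_iff]
    simp only [eq_comm]
  · have hw : w.1 ≠ Function.update u.1 i (u.1 i + 1) := fun h => hu (h ▸ w.2)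
    rw [mulCoord_newtonBasis_of_notMem ha i hu, if_neg hw]
    simp [hne.symm]

theorem toLex_update_succ (u : Fin n → ℕ) (i : Fin n) :
    toLex (Function.update u i (u i + 1)) = toLex u + toLex (Pi.single i 1) := by
  rw [← toLex_add]
  congr 1
  funext l
  by_cases hl : l = i
  · subst hl; simp
  · simp [hl]

theorem toLex_lt_update_succ (u : Fin n → ℕ) (i : Fin n) :
    toLex u < toLex (Function.update u i (u i + 1)) := by
  refine Pi.toLex_strictMono (Pi.lt_def.2 ⟨fun l => ?_, i, by simp⟩)
  by_cases hl : l = i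
  · subst hl; simp
  · simp [hl]

/-- The leading exponents of a space of functions that is closed under multiplication by the
coordinates form an upset. -/
theorem isBoxUpset_leadingIndices (ha : ∀ i, Set.InjOn (a i) (Set.Iio (D i)))
    {W : Submodule K (exponentBox D → K)} (hW : ∀ i, ∀ f ∈ W, mulCoord a D i f ∈ W)
    {U : Finset (Fin n → ℕ)} (hU : ∀ u, u ∈ U ↔ ∃ w ∈ leadingIndices (newtonBasis ha)
      (fun v : exponentBox D => toLex v.1) W, w.1 = u) :
    IsBoxUpset D U := by
  refine .of_step (fun u hu => ?_) fun u hu i hi => ?_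
  · obtain ⟨w, -, rfl⟩ := (hU u).1 hu
    exact w.2
  · obtain ⟨u, ⟨f, hf, hfu, hfv⟩, rfl⟩ := (hU u).1 hu
    have hub : Function.update u.1 i (u.1 i + 1) ∈ exponentBox D := by
      rw [mem_exponentBox]
      intro l
      by_cases hl : l = i
      · subst hl; simpa using hi
      · simpa [hl] using mem_exponentBox.1 u.2 l
    refine (hU _).2 ⟨⟨_, hub⟩, ⟨mulCoord a D i f, hW i f hf, ?_⟩, rfl⟩
    have hexp : ∀ w : exponentBox D, toLex u.1 < toLex w.1 →
        (newtonBasis ha).repr (mulCoord a D i f) w =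
          ∑ v, (newtonBasis ha).repr f v *
            if w.1 = Function.update v.1 i (v.1 i + 1) then 1 else 0 := by
      intro w hw
      conv_lhs => rw [← (newtonBasis ha).sum_repr f]
      simp only [map_sum, map_smul, Finsupp.coe_finsetSum, Finset.sum_apply, Finsupp.smul_apply,
        smul_eq_mul]
      refine Finset.sum_congr rfl fun v _ => ?_
      by_cases hwv : w = v
      · rw [hfv v (hwv ▸ hw), zero_mul, zero_mul]
      · rw [repr_mulCoord_newtonBasis ha i hwv]
    have hlt := toLex_lt_update_succ u.1 i
    constructor
    · rw [hexp _ hlt, Finset.sum_eq_single u]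
      · simpa using hfu
      · intro v _ hv
        rw [if_neg, mul_zero]
        intro h
        have h' := congrArg toLex h
        rw [toLex_update_succ, toLex_update_succ, add_left_inj] at h'
        exact hv (Subtype.ext (toLex.injective h').symm)
      · exact fun h => absurd (Finset.mem_univ u) h
    · intro w hw
      rw [hexp w (hlt.trans hw)]
      refine Finset.sum_eq_zero fun v _ => ?_
      split_ifs with h
      · rw [hfv v, zero_mul]
        simp only [h, toLex_update_succ] at hw
        exact lt_of_add_lt_add_right hw
      · rw [mul_zero]

/-- The span of the Newton functions of degree at most `d`. -/
def newtonDegreeLE (ha : ∀ i, Set.InjOn (a i) (Set.Iio (D i))) (d : ℕ) :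
    Submodule K (exponentBox D → K) :=
  Submodule.span K (newtonBasis ha '' {u | ∑ i, u.1 i ≤ d})

/-- The footprint bound: the support of a space `W` of functions of degree at most `d` on the grid
is at least as large as some upset with at least `dim W` elements of degree at most `d`. The upset
consists of the leading exponents of the ideal of all functions that vanish off the support. -/
theorem exists_isBoxUpset_card_le (ha : ∀ i, Set.InjOn (a i) (Set.Iio (D i))) {d : ℕ}
    {W : Submodule K (exponentBox D → K)} (hW : W ≤ newtonDegreeLE ha d) :
    ∃ U, IsBoxUpset D U ∧ U.card ≤ (codeSupport W).ncard ∧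
      Module.finrank K W ≤ (U.filter fun u => ∑ i, u i ≤ d).card := by
  classical
  -- The lexicographic order is not graded, but Newton expansions of elements of `W` only involve
  -- exponents of degree at most `d`, so any order compatible with addition serves.
  set o : exponentBox D → Lex (Fin n → ℕ) := fun v => toLex v.1
  have hoinj : Function.Injective o := fun u v h => Subtype.ext (toLex.injective h)
  let I : Submodule K (exponentBox D → K) :=
    { carrier := {f | ∀ v, v ∉ codeSupport W → f v = 0}
      add_mem' := fun hf hg v hv => by simp [hf v hv, hg v hv]
      zero_mem' := fun v _ => rfl
      smul_mem' := fun c f hf v hv => by simp [hf v hv] }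
  have hWI : W ≤ I := fun f hf v hv => by
    by_contra h
    exact hv ⟨f, hf, h⟩
  have hIX : ∀ i, ∀ f ∈ I, mulCoord a D i f ∈ I := fun i f hf v hv => by
    simp [mulCoord, hf v hv]
  have hIrank : Module.finrank K I ≤ (codeSupport W).ncard := by
    let φ : I →ₗ[K] (codeSupport W → K) :=
      (LinearMap.funLeft K K (Subtype.val : codeSupport W → exponentBox D)).comp I.subtype
    have hφ : Function.Injective φ := by
      rw [← LinearMap.ker_eq_bot, LinearMap.ker_eq_bot']
      intro f hf
      refine Subtype.ext (funext fun v => ?_)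
      by_cases hv : v ∈ codeSupport W
      · exact congrFun hf ⟨v, hv⟩
      · exact f.2 v hv
    have h := LinearMap.finrank_le_finrank_of_injective hφ
    rwa [Module.finrank_fintype_fun_eq_card, ← Nat.card_eq_fintype_card,
      Nat.card_coe_set_eq] at h
  set L := leadingIndices (newtonBasis ha) o I with hL
  refine ⟨L.toFinset.map (Function.Embedding.subtype _),
    isBoxUpset_leadingIndices ha hIX fun u => ?_, ?_, ?_⟩
  · rw [Finset.mem_map]
    simp only [Set.mem_toFinset]
    rfl
  · rw [Finset.card_map, ← Set.ncard_eq_toFinset_card']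
    exact (ncard_leadingIndices_le_finrank _ hoinj I).trans hIrank
  · refine (finrank_le_ncard_leadingIndices (newtonBasis ha) o W).trans ?_
    rw [Set.ncard_eq_toFinset_card', ← Finset.card_map (Function.Embedding.subtype _)]
    refine Finset.card_le_card fun u hu => ?_
    obtain ⟨w, hw, rfl⟩ := Finset.mem_map.1 hu
    obtain ⟨f, hf, hfw, hfv⟩ := Set.mem_toFinset.1 hw
    refine Finset.mem_filter.2 ⟨Finset.mem_map.2 ⟨w, Set.mem_toFinset.2 ⟨f, hWI hf, hfw, hfv⟩,
      rfl⟩, ?_⟩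
    exact (newtonBasis ha).mem_span_image.1 (hW hf) (Finsupp.mem_support_iff.2 hfw)

theorem mulCoord_mem_newtonDegreeLE (ha : ∀ i, Set.InjOn (a i) (Set.Iio (D i))) {d : ℕ} (i : Fin n)
    {f : exponentBox D → K} (hf : f ∈ newtonDegreeLE ha d) :
    mulCoord a D i f ∈ newtonDegreeLE ha (d + 1) := by
  have hle : newtonDegreeLE ha d ≤ (newtonDegreeLE ha (d + 1)).comap (mulCoord a D i) := by
    refine Submodule.span_le.2 ?_
    rintro _ ⟨u, hu, rfl⟩
    have hself : newtonBasis ha u ∈ newtonDegreeLE ha (d + 1) :=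
      Submodule.subset_span ⟨u, Nat.le_succ_of_le hu, rfl⟩
    rw [SetLike.mem_coe, Submodule.mem_comap]
    by_cases hub : Function.update u.1 i (u.1 i + 1) ∈ exponentBox D
    · rw [mulCoord_newtonBasis_of_mem ha i (w := ⟨_, hub⟩) rfl]
      refine add_mem (Submodule.subset_span ⟨_, ?_, rfl⟩) (Submodule.smul_mem _ _ hself)
      have h := Finset.add_sum_erase _ u.1 (Finset.mem_univ i)
      have hu' : ∑ i, u.1 i ≤ d := hu
      rw [Set.mem_ofPred_eq, Finset.sum_update_of_mem (Finset.mem_univ i),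
        Finset.sdiff_singleton_eq_erase]
      omega
    · rw [mulCoord_newtonBasis_of_notMem ha i hub]
      exact Submodule.smul_mem _ _ hself
  exact hle hf

theorem monomial_mem_newtonDegreeLE (ha : ∀ i, Set.InjOn (a i) (Set.Iio (D i)))
    (hD : ∀ i, 0 < D i) (m : Fin n → ℕ) :
    (fun v : exponentBox D => ∏ i, a i (v.1 i) ^ m i) ∈ newtonDegreeLE ha (∑ i, m i) := by
  obtain ⟨N, hN⟩ : ∃ N, ∑ i, m i = N := ⟨_, rfl⟩
  rw [hN]
  induction N generalizing m with
  | zero =>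
    have hm : ∀ i, m i = 0 := fun i => Finset.sum_eq_zero_iff.1 hN i (Finset.mem_univ i)
    refine Submodule.subset_span ⟨⟨0, mem_exponentBox.2 hD⟩, by simp, ?_⟩
    funext v
    simp [newtonBasis_apply, newtonFun, hm]
  | succ N ih =>
    obtain ⟨i, -, hi⟩ : ∃ i ∈ Finset.univ, m i ≠ 0 :=
      Finset.exists_ne_zero_of_sum_ne_zero (by omega)
    have hsum := Finset.add_sum_erase _ m (Finset.mem_univ i)
    have h := mulCoord_mem_newtonDegreeLE ha i (ih (Function.update m i (m i - 1)) (by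
      rw [Finset.sum_update_of_mem (Finset.mem_univ i), Finset.sdiff_singleton_eq_erase]
      omega))
    convert h using 1
    funext v
    simp only [mulCoord, LinearMap.mulLeft_apply, Pi.mul_apply]
    rw [← Finset.mul_prod_erase _ _ (Finset.mem_univ i), ← Finset.mul_prod_erase _
      (fun l => a l (v.1 l) ^ Function.update m i (m i - 1) l) (Finset.mem_univ i),
      Function.update_self, ← mul_assoc, mul_pow_sub_one hi]
    congr 1
    refine Finset.prod_congr rfl fun l hl => ?_
    rw [Function.update_of_ne (Finset.ne_of_mem_erase hl)]

end Newton

/-! ### Generalized Hamming weights of codes spanned by Newton functions -/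

section Weights

variable {K : Type*} [Field K] {n : ℕ} {D : Fin n → ℕ}

theorem mem_codeSupport_span {ι κ : Type*} {f : κ → ι → K} {i : ι} :
    i ∈ codeSupport (Submodule.span K (Set.range f)) ↔ ∃ j, f j i ≠ 0 := by
  constructor
  · rintro ⟨g, hg, hgi⟩
    by_contra hcon
    push Not at hcon
    have hle : Submodule.span K (Set.range f) ≤ LinearMap.ker (LinearMap.proj (R := K) i) := by
      rw [Submodule.span_le]
      rintro _ ⟨j, rfl⟩
      exact hcon j
    exact hgi (hle hg)
  · rintro ⟨j, hj⟩
    exact ⟨f j, Submodule.subset_span ⟨j, rfl⟩, hj⟩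

/-- Generalized Hamming weights are invariant under monomial equivalence of codes. -/
theorem genHammingWeight_map {ι κ : Type*} (C : Submodule K (ι → K)) (σ : ι ≃ κ)
    (Φ : (ι → K) ≃ₗ[K] (κ → K)) (hΦ : ∀ f i, Φ f (σ i) ≠ 0 ↔ f i ≠ 0) (r : ℕ) :
    genHammingWeight (C.map Φ.toLinearMap) r = genHammingWeight C r := by
  have hsupp : ∀ W : Submodule K (ι → K),
      (codeSupport (W.map Φ.toLinearMap)).ncard = (codeSupport W).ncard := by
    intro W
    rw [← Set.ncard_image_of_injective (codeSupport W) σ.injective]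
    congr 1
    ext j
    obtain ⟨i, rfl⟩ := σ.surjective j
    rw [σ.injective.mem_set_image]
    constructor
    · rintro ⟨_, ⟨f, hf, rfl⟩, h⟩
      exact ⟨f, hf, (hΦ f i).1 h⟩
    · rintro ⟨f, hf, h⟩
      exact ⟨_, ⟨f, hf, rfl⟩, (hΦ f i).2 h⟩
  unfold genHammingWeight
  congr 1
  ext w
  constructor
  · rintro ⟨W, hW, hr, hw⟩
    have hmap : (W.comap Φ.toLinearMap).map Φ.toLinearMap = W :=
      Submodule.map_comap_eq_of_surjective Φ.surjective W
    refine ⟨W.comap Φ.toLinearMap, ?_, ?_, ?_⟩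
    · rw [← Submodule.map_le_map_iff_of_injective (f := Φ.toLinearMap) Φ.injective, hmap]
      exact hW
    · rw [← hr, ← LinearEquiv.finrank_map_eq Φ (W.comap Φ.toLinearMap)]
      exact congrArg (fun S : Submodule K (κ → K) => Module.finrank K S) hmap
    · rw [← hw, ← hsupp, hmap]
  · rintro ⟨W, hW, hr, hw⟩
    exact ⟨W.map Φ.toLinearMap, Submodule.map_mono hW,
      (LinearEquiv.finrank_map_eq Φ W).trans hr, (hsupp W).trans hw⟩

/-- The generalized Hamming weights of a code that consists of functions of degree at most `d` on
a grid and contains the Newton functions of degree `d`. The minimum is attained by the span of the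
Newton functions whose exponents cover the lexicographically first exponent vector `e` of degree
`d - 1` in the coordinates `k, …, k + r - 1`. -/
theorem genHammingWeight_eq_of_newton {a : Fin n → ℕ → K}
    (ha : ∀ i, Set.InjOn (a i) (Set.Iio (D i))) (hmono : Monotone D) (hD : ∀ i, 2 ≤ D i)
    {k : Fin n} {e : Fin n → ℕ} (he : IsLexFirst D k e) {C : Submodule K (exponentBox D → K)}
    (hle : C ≤ newtonDegreeLE ha (∑ i, e i + 1))
    (hmem : ∀ u : exponentBox D, ∑ i, u.1 i = ∑ i, e i + 1 → newtonBasis ha u ∈ C)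
    {r : ℕ} (hr : 1 ≤ r) (hkr : (k : ℕ) + r ≤ n) :
    genHammingWeight C r = ∏ i, (D i - e i) - ∏ i ∈ {i : Fin n | (k : ℕ) + r ≤ (i : ℕ)}, D i := by
  have hD0 : ∀ i, 0 < D i := fun i => zero_lt_two.trans_le (hD i)
  have heb := he.mem_box hD0
  have heb' := mem_exponentBox.1 heb
  let idx : Fin r → Fin n := fun j => ⟨k + j, by omega⟩
  have hkidx : ∀ j, k ≤ idx j := fun j => Fin.le_def.2 (Nat.le_add_right _ _)
  have hidx : Function.Injective idx := fun i j h => by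
    have := congrArg Fin.val h
    exact Fin.ext (by simpa [idx] using this)
  have hroom : ∀ i, k ≤ i → e i + 1 < D i := by
    intro i hi
    rcases hi.eq_or_lt with rfl | hi
    · exact he.add_one_lt
    · rw [he.eq_zero i hi]
      exact hD i
  have hcover : ∀ j, Function.update e (idx j) (e (idx j) + 1) ∈ exponentBox D := by
    intro j
    rw [mem_exponentBox]
    intro l
    by_cases hl : l = idx j
    · rw [hl, Function.update_self]
      exact hroom _ (hkidx j)
    · rw [Function.update_of_ne hl]
      exact heb' l
  let w : Fin r → exponentBox D := fun j => ⟨_, hcover j⟩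
  have hw : Function.Injective w := by
    intro i j h
    have h1 := congrFun (congrArg Subtype.val h) (idx i)
    by_contra hne
    have : idx i ≠ idx j := fun h => hne (hidx h)
    simp [w, this] at h1
  have hwsum : ∀ j, ∑ i, (w j).1 i = ∑ i, e i + 1 := by
    intro j
    have h1 := Finset.add_sum_erase _ e (Finset.mem_univ (idx j))
    simp only [w]
    rw [Finset.sum_update_of_mem (Finset.mem_univ (idx j)), Finset.sdiff_singleton_eq_erase]
    omega
  set W := Submodule.span K (Set.range fun j => newtonBasis ha (w j)) with hW
  have hrank : Module.finrank K W = r := by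
    have h := finrank_span_eq_card ((newtonBasis ha).linearIndependent.comp w hw)
    rwa [Fintype.card_fin] at h
  have hWC : W ≤ C := by
    rw [hW, Submodule.span_le]
    rintro _ ⟨j, rfl⟩
    exact hmem _ (hwsum j)
  have hmap : (codeSupport W).ncard =
      (boxAbove D e \ boxCylinder D e (k + r)).card := by
    rw [← Set.ncard_coe_finset, ← Set.ncard_image_of_injective _ Subtype.val_injective]
    congr 1
    ext v
    rw [Finset.mem_coe, Finset.mem_sdiff, mem_boxAbove, mem_boxCylinder heb]
    simp only [Set.mem_image, hW, mem_codeSupport_span, newtonBasis_apply]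
    constructor
    · rintro ⟨v, ⟨j, hj⟩, rfl⟩
      rw [newtonFun_ne_zero_iff ha v.2] at hj
      have hself := hj (idx j)
      simp only [w, Function.update_self] at hself
      refine ⟨⟨fun l => ?_, v.2⟩, fun h => ?_⟩
      · have hl := hj l
        by_cases h : l = idx j
        · rw [h]
          exact (Nat.le_succ _).trans hself
        · simpa [w, h] using hl
      · have := h.1 (idx j) (by simp [idx])
        omega
    · rintro ⟨⟨hev, hvb⟩, hnot⟩
      have hvb' := mem_exponentBox.1 hvb
      refine ⟨⟨v, hvb⟩, ?_, rfl⟩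
      obtain ⟨i, hi, hne⟩ : ∃ i : Fin n, (i : ℕ) < k + r ∧ v i ≠ e i := by
        by_contra hcon
        push Not at hcon
        exact hnot ⟨hcon, hvb⟩
      have hlt : e i < v i := lt_of_le_of_ne (hev i) hne.symm
      have hki : k ≤ i := by
        by_contra hcon
        have := he.add_one_eq i (not_le.1 hcon)
        have := hvb' i
        omega
      have hki' : (k : ℕ) ≤ i := hki
      have hidxi : idx ⟨i - k, by omega⟩ = i := Fin.ext (by simp [idx]; omega)
      refine ⟨⟨i - k, by omega⟩, (newtonFun_ne_zero_iff ha hvb).2 fun l => ?_⟩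
      simp only [w, hidxi]
      by_cases hl : l = i
      · rw [hl, Function.update_self]
        exact hlt
      · rw [Function.update_of_ne hl]
        exact hev l
  have hsub : boxCylinder D e (k + r) ⊆ boxAbove D e := by
    intro v hv
    obtain ⟨h1, h2⟩ := (mem_boxCylinder heb).1 hv
    refine mem_boxAbove.2 ⟨fun i => ?_, h2⟩
    by_cases hi : (i : ℕ) < k + r
    · exact (h1 i hi).ge
    · rw [he.eq_zero i (Fin.lt_def.2 (by omega))]
      exact Nat.zero_le _
  rw [Finset.card_sdiff_of_subset hsub, card_boxAbove, card_boxCylinder] at hmap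
  refine le_antisymm (Nat.sInf_le ⟨W, hWC, hrank, hmap⟩)
    (le_csInf ⟨_, W, hWC, hrank, hmap⟩ ?_)
  rintro _ ⟨W', hW', hr', rfl⟩
  obtain ⟨U, hU, hUcard, hUr⟩ := exists_isBoxUpset_card_le ha (hW'.trans hle)
  have h := he.prod_sub_le_card_add hmono hD0 hU hr (hr' ▸ hUr)
  omega

end Weights

/-! ### Homogeneous forms on a projective grid -/

section Forms

open MvPolynomial

variable {K : Type*} [Field K] {n : ℕ} {D : Fin n → ℕ}

theorem exists_enumeration (S : Finset K) :
    ∃ a : ℕ → K, Set.InjOn a (Set.Iio S.card) ∧ ∀ x, x ∈ S ↔ ∃ t < S.card, a t = x := by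
  refine ⟨fun t => if h : t < S.card then S.equivFin.symm ⟨t, h⟩ else 0, ?_, fun x => ?_⟩
  · intro s hs t ht hst
    simp only [Set.mem_Iio] at hs ht
    simp only [hs, ht, dif_pos] at hst
    simpa using S.equivFin.symm.injective (Subtype.ext hst)
  · constructor
    · intro hx
      refine ⟨S.equivFin ⟨x, hx⟩, (S.equivFin ⟨x, hx⟩).2, ?_⟩
      simp
    · rintro ⟨t, ht, rfl⟩
      simp [ht]

/-- The affine point `(a i (v i))_i`, with last homogeneous coordinate `1`. -/
def gridPoint (a : Fin n → ℕ → K) (v : Fin n → ℕ) : Fin (n + 1) → K :=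
  Fin.snoc (fun i => a i (v i)) 1

theorem gridPoint_castSucc (a : Fin n → ℕ → K) (v : Fin n → ℕ) (i : Fin n) :
    gridPoint a v i.castSucc = a i (v i) := by
  simp [gridPoint]

theorem gridPoint_last (a : Fin n → ℕ → K) (v : Fin n → ℕ) :
    gridPoint a v (Fin.last n) = 1 := by
  simp [gridPoint]

theorem eval_gridPoint_mem_newtonDegreeLE {a : Fin n → ℕ → K}
    (ha : ∀ i, Set.InjOn (a i) (Set.Iio (D i))) (hD : ∀ i, 0 < D i) {d : ℕ}
    {f : MvPolynomial (Fin (n + 1)) K} (hf : f.IsHomogeneous d) :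
    (fun v : exponentBox D => eval (gridPoint a v.1) f) ∈ newtonDegreeLE ha d := by
  have hsum : (fun v : exponentBox D => eval (gridPoint a v.1) f) = ∑ m ∈ f.support,
      f.coeff m • fun v : exponentBox D => ∏ i, a i (v.1 i) ^ m i.castSucc := by
    funext v
    simp only [eval_eq', Finset.sum_apply, Pi.smul_apply, smul_eq_mul, Fin.prod_univ_castSucc,
      gridPoint_castSucc, gridPoint_last, one_pow, mul_one]
  rw [hsum]
  refine Submodule.sum_mem _ fun m hm => Submodule.smul_mem _ _ ?_
  have hdeg : ∑ i : Fin n, m i.castSucc ≤ d := by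
    have h := hf (mem_support_iff.1 hm)
    rw [Finsupp.weight_apply, Finsupp.sum_fintype _ _ (by simp), Fin.sum_univ_castSucc] at h
    simp only [Pi.one_apply, smul_eq_mul, mul_one] at h
    omega
  refine Submodule.span_mono (Set.image_mono fun u hu => ?_)
    (monomial_mem_newtonDegreeLE ha hD fun i => m i.castSucc)
  exact le_trans hu hdeg

/-- The homogenization of the Newton polynomial with exponent `u`. -/
noncomputable def newtonForm (a : Fin n → ℕ → K) (u : Fin n → ℕ) : MvPolynomial (Fin (n + 1)) K :=
  ∏ i, ∏ t ∈ Finset.range (u i), (X i.castSucc - C (a i t) * X (Fin.last n))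

theorem isHomogeneous_newtonForm (a : Fin n → ℕ → K) (u : Fin n → ℕ) :
    (newtonForm a u).IsHomogeneous (∑ i, u i) := by
  refine IsHomogeneous.prod _ _ _ fun i _ => ?_
  have h := IsHomogeneous.prod (Finset.range (u i))
    (fun t => (X i.castSucc - C (a i t) * X (Fin.last n) : MvPolynomial (Fin (n + 1)) K))
    (fun _ => 1) fun t _ => (isHomogeneous_X K _).sub (by
      simpa using (isHomogeneous_C (Fin (n + 1)) (a i t)).mul (isHomogeneous_X K (Fin.last n)))
  simpa using h

theorem eval_newtonForm (a : Fin n → ℕ → K) (u v : Fin n → ℕ) :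
    eval (gridPoint a v) (newtonForm a u) = newtonFun a u v := by
  simp [newtonForm, newtonFun, gridPoint_castSucc, gridPoint_last]

theorem eval_smul_of_isHomogeneous {d : ℕ} {f : MvPolynomial (Fin (n + 1)) K}
    (hf : f.IsHomogeneous d) (c : K) (x : Fin (n + 1) → K) :
    eval (c • x) f = c ^ d * eval x f := by
  rw [eval_eq', eval_eq', Finset.mul_sum]
  refine Finset.sum_congr rfl fun m hm => ?_
  have h := hf (mem_support_iff.1 hm)
  rw [Finsupp.weight_apply, Finsupp.sum_fintype _ _ (by simp)] at h
  simp only [Pi.one_apply, smul_eq_mul, mul_one] at h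
  simp only [Pi.smul_apply, smul_eq_mul, mul_pow, Finset.prod_mul_distrib,
    Finset.prod_pow_eq_pow_sum, h]
  ring

/-- Representatives of the points of a projective cartesian set are, up to scalars, the grid
points, each taken once. -/
theorem exists_equiv_exponentBox {A : Fin n → Finset K} {a : Fin n → ℕ → K}
    (ha : ∀ i, Set.InjOn (a i) (Set.Iio (A i).card))
    (haA : ∀ i x, x ∈ A i ↔ ∃ t < (A i).card, a i t = x)
    {m : ℕ} {P : Fin m → Fin (n + 1) → K} (hP : ∀ i, P i ≠ 0)
    (hPinj : Function.Injective fun i => Projectivization.mk K (P i) (hP i))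
    (hPrange : Set.range (fun i => Projectivization.mk K (P i) (hP i)) = projCartesianSet A) :
    ∃ (σ : Fin m ≃ exponentBox fun i => (A i).card) (c : Fin m → K),
      (∀ i, c i ≠ 0) ∧ ∀ i, P i = c i • gridPoint a (σ i).1 := by
  have h1 : ∀ i, ∃ (v : exponentBox fun i => (A i).card) (c : K),
      c ≠ 0 ∧ P i = c • gridPoint a v.1 := by
    intro i
    have hi : Projectivization.mk K (P i) (hP i) ∈ projCartesianSet A := hPrange ▸ ⟨i, rfl⟩
    obtain ⟨x, hx, hmk⟩ := hi
    choose t ht htx using fun l => (haA l (x l)).1 (hx l)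
    obtain ⟨c, hc⟩ := (Projectivization.mk_eq_mk_iff' K _ _ _ _).1 hmk
    refine ⟨⟨t, mem_exponentBox.2 ht⟩, c, ?_, ?_⟩
    · rintro rfl
      exact hP i (by rw [← hc, zero_smul])
    · rw [← hc, gridPoint]
      simp only [htx]
  choose v c hc hPc using h1
  have hbij : Function.Bijective v := by
    constructor
    · intro i j hij
      refine hPinj ((Projectivization.mk_eq_mk_iff' K _ _ _ _).2 ⟨c i / c j, ?_⟩)
      rw [hPc i, hPc j, hij, smul_smul, div_mul_cancel₀ _ (hc j)]
    · intro w
      have hw : Projectivization.mk K (gridPoint a w.1) (snoc_one_ne_zero _) ∈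
          Set.range fun i => Projectivization.mk K (P i) (hP i) := by
        rw [hPrange]
        exact ⟨_, fun l => (haA l _).2 ⟨w.1 l, mem_exponentBox.1 w.2 l, rfl⟩, rfl⟩
      obtain ⟨i, hi⟩ := hw
      obtain ⟨b, hb⟩ := (Projectivization.mk_eq_mk_iff' K _ _ _ _).1 hi
      rw [hPc i] at hb
      have hbc : b = c i := by
        have := congrFun hb (Fin.last n)
        simpa [gridPoint_last] using this
      refine ⟨i, Subtype.ext (funext fun l => ?_)⟩
      have h2 := congrFun hb l.castSucc
      simp only [Pi.smul_apply, gridPoint_castSucc, smul_eq_mul, hbc] at h2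
      exact (ha l (mem_exponentBox.1 w.2 l) (mem_exponentBox.1 (v i).2 l)
        (mul_left_cancel₀ (hc i) h2)).symm
  exact ⟨Equiv.ofBijective v hbij, c, hc, hPc⟩

/-- The generalized Hamming weights of the Reed--Muller-type code of a projective cartesian set, in
terms of the lexicographically first exponent vector of degree `d - 1`. -/
theorem genHammingWeight_reedMullerTypeCode {A : Fin n → Finset K}
    (hcard : ∀ i, 2 ≤ (A i).card) (hmono : Monotone fun i => (A i).card)
    {m : ℕ} {P : Fin m → Fin (n + 1) → K} (hP : ∀ i, P i ≠ 0)
    (hPinj : Function.Injective fun i => Projectivization.mk K (P i) (hP i))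
    (hPrange : Set.range (fun i => Projectivization.mk K (P i) (hP i)) = projCartesianSet A)
    {h : Fin m → MvPolynomial (Fin (n + 1)) K} (hne : ∀ i, eval (P i) (h i) ≠ 0)
    {k : Fin n} {e : Fin n → ℕ} (he : IsLexFirst (fun i => (A i).card) k e)
    {r : ℕ} (hr : 1 ≤ r) (hkr : (k : ℕ) + r ≤ n) :
    genHammingWeight (reedMullerTypeCode (∑ i, e i + 1) P h) r =
      ∏ i, ((A i).card - e i) - ∏ i ∈ {i : Fin n | (k : ℕ) + r ≤ (i : ℕ)}, (A i).card := by
  choose a ha haA using fun i => exists_enumeration (A i)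
  obtain ⟨σ, c, hc, hPc⟩ := exists_equiv_exponentBox ha haA hP hPinj hPrange
  set d := ∑ i, e i + 1
  have hs : ∀ i, eval (P i) (h i) / c i ^ d ≠ 0 := fun i => div_ne_zero (hne i) (pow_ne_zero _ (hc i))
  let Φ : (Fin m → K) ≃ₗ[K] ((exponentBox fun i => (A i).card) → K) :=
    (LinearEquiv.piCongrRight fun i => LinearEquiv.smulOfNeZero K K _ (hs i)) ≪≫ₗ
      LinearEquiv.funCongrLeft K K σ.symm
  have hΦ : ∀ f i, Φ f (σ i) = eval (P i) (h i) / c i ^ d * f i := fun f i => by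
    simp [Φ, LinearEquiv.funCongrLeft_apply, LinearMap.funLeft_apply]
  have hΦeval : ∀ f : homogeneousSubmodule (Fin (n + 1)) K d,
      Φ (evalMap d P h f) = fun v => eval (gridPoint a v.1) f.1 := by
    intro f
    funext v
    obtain ⟨i, rfl⟩ := σ.surjective v
    rw [hΦ]
    simp only [evalMap, LinearMap.coe_mk, AddHom.coe_mk]
    have h1 : eval (P i) f.1 = c i ^ d * eval (gridPoint a (σ i).1) f.1 := by
      rw [hPc i, eval_smul_of_isHomogeneous f.2]
    have h2 := hne i
    have h3 := pow_ne_zero d (hc i)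
    rw [h1]
    field_simp
  rw [← genHammingWeight_map _ σ Φ (fun f i => by simp [hΦ, (hs i)]) r]
  refine genHammingWeight_eq_of_newton ha hmono hcard he ?_ (fun u hu => ?_) hr hkr
  · rintro _ ⟨_, ⟨f, rfl⟩, rfl⟩
    rw [LinearEquiv.coe_coe, hΦeval]
    exact eval_gridPoint_mem_newtonDegreeLE ha (fun i => zero_lt_two.trans_le (hcard i)) f.2
  · have hform : (newtonForm a u.1).IsHomogeneous d := by
      simpa only [hu] using isHomogeneous_newtonForm a u.1
    refine ⟨_, ⟨⟨newtonForm a u.1, hform⟩, rfl⟩, ?_⟩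
    rw [LinearEquiv.coe_coe, hΦeval]
    funext v
    rw [eval_newtonForm, newtonBasis_apply]

end Forms

/-! ### The degree decomposition -/

section Decomposition

variable {n : ℕ} {δ : ℕ → ℕ} {d : ℕ}

theorem existsUnique_isDegreeDecomposition (hd : 1 ≤ d)
    (hle : d ≤ ∑ i ∈ Finset.Icc 1 n, (δ i - 1)) :
    ∃! p : ℕ × ℕ, IsDegreeDecomposition n δ d p.1 p.2 := by
  have hsucc : ∀ j, ∑ i ∈ Finset.Icc 1 (j + 1), (δ i - 1) =
      ∑ i ∈ Finset.Icc 1 j, (δ i - 1) + (δ (j + 1) - 1) := fun j =>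
    Finset.sum_Icc_succ_top (by omega) _
  have hmono : Monotone fun j => ∑ i ∈ Finset.Icc 1 j, (δ i - 1) :=
    monotone_nat_of_le_succ fun j => by rw [hsucc]; omega
  have hex : ∃ j, d ≤ ∑ i ∈ Finset.Icc 1 j, (δ i - 1) := ⟨n, hle⟩
  classical
  have hspec := Nat.find_spec hex
  have hmin := fun j => Nat.find_min hex (m := j)
  have hn := Nat.find_min' hex hle
  obtain ⟨k, hk⟩ : ∃ k, Nat.find hex = k + 1 := by
    refine Nat.exists_eq_succ_of_ne_zero fun h0 => ?_
    rw [h0] at hspec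
    simp at hspec
    omega
  rw [hk] at hspec hn
  have hkmin := hmin k (by omega)
  rw [hsucc] at hspec
  refine ⟨(k, d - ∑ i ∈ Finset.Icc 1 k, (δ i - 1)), ⟨hn, ?_, ?_, ?_⟩, ?_⟩
  · simp only; omega
  · simp only; omega
  · simp only; omega
  · rintro ⟨k', ℓ'⟩ ⟨h1, h2, h3, h4⟩
    simp only at h1 h2 h3 h4
    have hkk : k' = k := by
      rcases lt_trichotomy k' k with h | h | h
      · have := hmono h
        simp only [Nat.succ_eq_add_one, hsucc] at this
        omega
      · exact h
      · have := hmono h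
        simp only [Nat.succ_eq_add_one, hsucc] at this
        omega
    subst hkk
    exact Prod.ext rfl (by simp only; omega)

theorem prod_Icc_eq_prod_range {M : Type*} [CommMonoid M] (f : ℕ → M) (s t : ℕ) :
    ∏ i ∈ Finset.Icc (s + 1) t, f i = ∏ i ∈ Finset.range (t - s), f (s + i + 1) := by
  have : Finset.Icc (s + 1) t = Finset.Ico (s + 1) (t + 1) := by
    ext; simp
  rw [this, Finset.prod_Ico_eq_prod_range, Nat.add_sub_add_right]
  exact Finset.prod_congr rfl fun i _ => by rw [add_right_comm]

theorem prod_fin_ge_eq_prod_Icc {M : Type*} [CommMonoid M] (f : ℕ → M) {t : ℕ} (ht : t ≤ n) :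
    ∏ i ∈ {i : Fin n | t ≤ (i : ℕ)}, f (i + 1) = ∏ i ∈ Finset.Icc (t + 1) n, f i := by
  obtain ⟨q, rfl⟩ := Nat.exists_eq_add_of_le ht
  rw [prod_Icc_eq_prod_range, Finset.prod_filter,
    Fin.prod_univ_eq_prod_range (fun i => if t ≤ i then f (i + 1) else 1) (t + q),
    Finset.prod_range_add, Nat.add_sub_cancel_left, Finset.prod_eq_one, one_mul]
  · exact Finset.prod_congr rfl fun i _ => if_pos (Nat.le_add_right _ _)
  · exact fun i hi => if_neg (not_le.2 (Finset.mem_range.1 hi))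

/-- The exponent vector `(δ 1 - 1, …, δ k - 1, ℓ - 1, 0, …, 0)`. -/
def cornerExponent (δ : ℕ → ℕ) (k ℓ i : ℕ) : ℕ :=
  if i < k then δ (i + 1) - 1 else if i = k then ℓ - 1 else 0

theorem sum_cornerExponent {k ℓ : ℕ} (h : IsDegreeDecomposition n δ d k ℓ) :
    ∑ i : Fin n, cornerExponent δ k ℓ i + 1 = d := by
  obtain ⟨h1, h2, h3, h4⟩ := h
  obtain ⟨q, rfl⟩ := Nat.exists_eq_add_of_le h1
  have hz : ∑ i ∈ Finset.range q, cornerExponent δ k ℓ (k + 1 + i) = 0 :=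
    Finset.sum_eq_zero fun i _ => by
      rw [cornerExponent, if_neg (by omega), if_neg (by omega)]
  have hs : ∑ i ∈ Finset.range k, cornerExponent δ k ℓ i = ∑ i ∈ Finset.Icc 1 k, (δ i - 1) := by
    have : Finset.Icc 1 k = Finset.Ico 1 (k + 1) := by ext; simp
    rw [this, Finset.sum_Ico_eq_sum_range, Nat.add_sub_cancel]
    exact Finset.sum_congr rfl fun i hi => by
      rw [cornerExponent, if_pos (Finset.mem_range.1 hi), add_comm]
  rw [Fin.sum_univ_eq_sum_range, Finset.sum_range_add, Finset.sum_range_succ, hz, hs,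
    cornerExponent, if_neg (lt_irrefl k), if_pos rfl]
  omega

theorem prod_sub_cornerExponent (hδ : ∀ i < n, 2 ≤ δ (i + 1)) {k ℓ : ℕ}
    (h : IsDegreeDecomposition n δ d k ℓ) :
    ∏ i : Fin n, (δ (i + 1) - cornerExponent δ k ℓ i) =
      (δ (k + 1) - ℓ + 1) * ∏ i ∈ Finset.Icc (k + 2) n, δ i := by
  obtain ⟨h1, h2, h3, h4⟩ := h
  obtain ⟨q, rfl⟩ := Nat.exists_eq_add_of_le h1
  rw [Fin.prod_univ_eq_prod_range (fun i => δ (i + 1) - cornerExponent δ k ℓ i),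
    Finset.prod_range_add, Finset.prod_range_succ, Finset.prod_eq_one, one_mul,
    prod_Icc_eq_prod_range, Nat.add_sub_cancel_left]
  · congr 1
    · rw [cornerExponent, if_neg (lt_irrefl k), if_pos rfl]
      omega
    · refine Finset.prod_congr rfl fun i _ => ?_
      rw [cornerExponent, if_neg (by omega), if_neg (by omega), Nat.sub_zero]
  · intro i hi
    rw [Finset.mem_range] at hi
    have := hδ i (by omega)
    rw [cornerExponent, if_pos hi]
    omega

end Decomposition

theorem theorem2p1 {K : Type*} [Field K] [Finite K] (n : ℕ) (A : Fin n → Finset K)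
    (δ : ℕ → ℕ) (hδ : ∀ i : Fin n, (A i).card = δ ((i : ℕ) + 1))
    (hcard : ∀ i : Fin n, 2 ≤ (A i).card)
    (hmono : ∀ i j : Fin n, i ≤ j → (A i).card ≤ (A j).card)
    (d : ℕ) (hd : 1 ≤ d)
    (m : ℕ) (P : Fin m → Fin (n + 1) → K) (hP : ∀ i, P i ≠ 0)
    (hPinj : Function.Injective fun i => Projectivization.mk K (P i) (hP i))
    (hPrange : Set.range (fun i => Projectivization.mk K (P i) (hP i)) = projCartesianSet A)
    (h : Fin m → MvPolynomial (Fin (n + 1)) K)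
    (hhom : ∀ i, (h i).IsHomogeneous d)
    (hne : ∀ i, MvPolynomial.eval (P i) (h i) ≠ 0) :
    (d ≤ ∑ i ∈ Finset.Icc 1 n, (δ i - 1) →
      ∃! p : ℕ × ℕ, IsDegreeDecomposition n δ d p.1 p.2) ∧
    ∀ k ℓ r : ℕ, IsDegreeDecomposition n δ d k ℓ → 1 ≤ r →
      (k + r < n →
        genHammingWeight (reedMullerTypeCode d P h) r =
          (∏ i ∈ Finset.Icc (k + r + 1) n, δ i) *
            ((δ (k + 1) - ℓ + 1) * (∏ i ∈ Finset.Icc (k + 2) (k + r), δ i) - 1)) ∧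
      (k + r = n →
        genHammingWeight (reedMullerTypeCode d P h) r =
          (δ (k + 1) - ℓ + 1) * (∏ i ∈ Finset.Icc (k + 2) n, δ i) - 1) := by
  have hδ2 : ∀ i < n, 2 ≤ δ (i + 1) := fun i hi => by
    have := hcard ⟨i, hi⟩
    rwa [hδ] at this
  refine ⟨existsUnique_isDegreeDecomposition hd, fun k ℓ r hkl hr => ?_⟩
  have hdsum := sum_cornerExponent hkl
  have hkn : k < n := hkl.1
  have hlex : IsLexFirst (fun i => (A i).card) ⟨k, hkn⟩
      (fun i => cornerExponent δ k ℓ i) := by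
    refine ⟨fun i hi => ?_, ?_, fun i hi => ?_⟩
    · have hi' : (i : ℕ) < k := hi
      have := hδ2 i i.2
      simp only [hδ, cornerExponent, if_pos hi']
      omega
    · have h1 := hkl.2.2.1
      have h2 := hkl.2.2.2
      simp only [hδ, cornerExponent, lt_irrefl, if_false, if_true]
      omega
    · have hi' : k < (i : ℕ) := hi
      simp only [cornerExponent, if_neg hi'.not_gt, if_neg hi'.ne']
  have hweight : k + r ≤ n → genHammingWeight (reedMullerTypeCode d P h) r =
      (δ (k + 1) - ℓ + 1) * (∏ i ∈ Finset.Icc (k + 2) n, δ i) -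
        ∏ i ∈ Finset.Icc (k + r + 1) n, δ i := by
    intro hkr
    have key := genHammingWeight_reedMullerTypeCode hcard (fun i j hij => hmono i j hij) hP hPinj
      hPrange hne hlex hr hkr
    simp only [hδ] at key
    rwa [hdsum, prod_sub_cornerExponent hδ2 hkl,
      prod_fin_ge_eq_prod_Icc (fun i => δ i) hkr] at key
  refine ⟨fun hkr => ?_, fun hkr => ?_⟩
  · have hsplit : ∏ i ∈ Finset.Icc (k + 2) n, δ i =
        (∏ i ∈ Finset.Icc (k + 2) (k + r), δ i) * ∏ i ∈ Finset.Icc (k + r + 1) n, δ i := by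
      simp only [← Finset.Ico_add_one_right_eq_Icc]
      exact (Finset.prod_Ico_consecutive _ (by omega) (by omega)).symm
    rw [hweight hkr.le, hsplit, Nat.mul_sub_one, ← mul_assoc,
      mul_comm (∏ i ∈ Finset.Icc (k + r + 1) n, δ i)]
  · rw [hweight hkr.le, ← hkr, Finset.Icc_eq_empty (a := k + r + 1) (by omega),
      Finset.prod_empty]
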